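/- Let $a_0,\dots,a_6\in\mathbb R$ and let $J=\mathbb R^5$ with coordinates $(x,y,p,q,z)$. Put $F=q^2+a_6p^6+a_5p^5+a_4p^4+a_3p^3+a_2p^2+a_1p+a_0$ (the case $b=0$ of the equation $z'=y''^2+\sum_{i=0}^6a_iy'^i+bz$), and let $g_F$ be the metric of signature $(3,2)$ on $J$ with $$\begin{aligned}15\cdot 2^{-2/3}g_F={}&(9a_2+27a_3p+54a_4p^2+90a_5p^3+135a_6p^4)\,dy^2\\&+(15a_0-6a_2p^2-3a_3p^3+9a_4p^4+30a_5p^5+60a_6p^6+5q^2)\,dx^2\\&+(15a_1+12a_2p-9a_3p^2-48a_4p^3-105a_5p^4-180a_6p^5)\,dx\,dy\\&+20\,dp^2-10q\,dp\,dx-30\,dq\,dy-15\,dx\,dz+30p\,dq\,dx.\end{aligned}$$ On $J$ consider the 1-forms $$\begin{aligned}&\theta^1=dy-p\,dx,\quad \theta^2=dz-F\,dx-2q(dp-q\,dx),\quad \theta^3=-\tfrac{2^{4/3}}{\sqrt3}(dp-q\,dx),\quad \theta^4=2^{-1/3}dx,\\&15\cdot2^{1/3}\theta^5=(9a_2+27a_3p+54a_4p^2+90a_5p^3+135a_6p^4)(dy-p\,dx)-30\,dq\\&\qquad\qquad+15(a_1+2a_2p+3a_3p^2+4a_4p^3+5a_5p^4+6a_6p^5)\,dx.\end{aligned}$$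 On $M=J\times\mathbb R_+\times\mathbb R$, with additional coordinates $t>0$ and $u$, and with the projection $\pi:M\to J$, let (omitting $\pi^*$) $$\begin{aligned}\tilde g_F={}&t^2g_F-2\,dt\,du\\&-2tu\Big[\tfrac1{20}(-2a_2+3a_3p+6a_4p^2-20a_5p^3-120a_6p^4)dx^2-\tfrac9{20}(a_3-10a_5p^2-40a_6p^3)dx\,dy-\tfrac9{10}(a_4+5a_5p+15a_6p^2)dy^2\Big]\\&+u^2\Big[\tfrac{3}{20\cdot2^{2/3}}(a_4-10a_5p+60a_6p^2)dx^2+\tfrac{9}{4\cdot2^{2/3}}(a_5-12a_6p)dx\,dy+\tfrac{81}{4\cdot2^{2/3}}a_6\,dy^2\Big],\end{aligned}$$ and put $\theta^0=dt$, $\theta^6=du$. Let $\Sigma=\{t=1,\ u=0\}\subset M$, identified with $J$ by $\pi$. Let $\omega_{LC}$ be the $7\times7$ matrix of connection 1-forms of the Levi-Civita connection of $\tilde g_F$ in the coframe $(\theta^0,\dots,\theta^6)$, and let $\omega_{G_2}$ be the Cartan normal conformal connection of $[g_F]$ in the coframe $(\theta^1,\dots,\theta^5)$, that is, $$\omega_{G_2}=\begin{pmatrix}0&-\mathsf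 P_j&0\\ \theta^i&\Gamma^i{}_j&-\mathsf P^i\\ 0&\theta_j&0\end{pmatrix},$$ where $\Gamma^i{}_j$ are the Levi-Civita connection forms of $g_F$ in this coframe, $\mathsf P_i=\mathsf P_{ij}\theta^j$ with $\mathsf P_{ij}=\frac13(R_{ij}-\frac18R\,g_{ij})$ the Schouten tensor, and indices are raised and lowered with $g_F$. Then: 1. $(\theta^1,\dots,\theta^5)$ is a coframe on $J$ with $g_F=2\theta^1\theta^5-2\theta^2\theta^4+(\theta^3)^2$, and $\tilde g_F$ is nondegenerate and Ricci-flat on all of $M$. 2. The connections coincide on $\Sigma$: the pullback of $\omega_{LC}$ to $\Sigma$ equals $\omega_{G_2}$. 3. The torsion $d\theta^i+\pi^*(\omega_{G_2})^i{}_j\wedge\theta^j$ of $\pi^*\omega_{G_2}$ in the coframe $(\theta^0,\dots,\theta^6)$ has zero pullback to $\Sigma$ and is nonzero at every point of $M\setminus\Sigma$. 4. If $(a_3,a_4,a_5,a_6)\ne0$, then the curvature $\Omega_{LC}=d\omega_{LC}+\omega_{LC}\wedge\omega_{LC}$ depends on $t$ and on $u$: the components of its entries with respect to the coordinate differentials are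 neither all independent of $t$ nor all independent of $u$. If $(a_4,a_5,a_6)\ne0$, this holds over every point of $J$: for every $X\in J$ and $u\in\mathbb R$ the map $t\mapsto\Omega_{LC}(X,t,u)$ is not constant, and for every $X\in J$ and $t>0$ the map $u\mapsto\Omega_{LC}(X,t,u)$ is not constant. 5. If $(a_4,a_5,a_6)\ne0$, then even on $\Sigma$ the curvatures differ: at every point of $\Sigma$, the matrices of 2-forms $\Omega_{LC}$ and $\pi^*(d\omega_{G_2}+\omega_{G_2}\wedge\omega_{G_2})$ on the tangent space of $M$ are different. -/

import Mathlib

open Matrix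

noncomputable section

namespace AmbientG2

/-! Differential forms and metrics on (open subsets of) `ℝⁿ`, in the standard coordinates. -/

/-- A 1-form `α = ∑ μ, α_μ dx^μ`, given by its coefficients: `α x μ = α_μ(x)`. -/
abbrev Form1 (n : ℕ) := (Fin n → ℝ) → Fin n → ℝ

/-- A 2-form, given by its (antisymmetric) matrix of values on the coordinate vector fields:
`Ω x μ ν = Ω(∂_μ, ∂_ν)(x)`. -/
abbrev Form2 (n : ℕ) := (Fin n → ℝ) → Matrix (Fin n) (Fin n) ℝ

/-- A symmetric bilinear form field: `g x μ ν = g(∂_μ, ∂_ν)(x)`. -/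
abbrev Metric (n : ℕ) := (Fin n → ℝ) → Matrix (Fin n) (Fin n) ℝ

/-- A family of `n` 1-forms, meant to be a coframe. -/
abbrev Coframe (n : ℕ) := Fin n → Form1 n

/-- An `m × m` matrix of 1-forms on `ℝⁿ`. -/
abbrev ConnForm (m n : ℕ) := Fin m → Fin m → Form1 n

/-- The partial derivative `∂f/∂x^μ` at `x`. -/
def pd {n : ℕ} (μ : Fin n) (f : (Fin n → ℝ) → ℝ) (x : Fin n → ℝ) : ℝ :=
  fderiv ℝ f x (Pi.single μ 1)

/-- Exterior derivative of a 1-form. -/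
def d1 {n : ℕ} (α : Form1 n) : Form2 n :=
  fun x => Matrix.of fun μ ν => pd μ (fun y => α y ν) x - pd ν (fun y => α y μ) x

/-- `α ∧ β` for 1-forms, with `(α ∧ β)(v, w) = α(v) β(w) - α(w) β(v)`. -/
def wedge {n : ℕ} (α β : Form1 n) : Form2 n :=
  fun x => Matrix.of fun μ ν => α x μ * β x ν - α x ν * β x μ

/-- The symmetric product `αβ = (α ⊗ β + β ⊗ α) / 2` of covectors. -/
def sp {n : ℕ} (α β : Fin n → ℝ) : Matrix (Fin n) (Fin n) ℝ :=
  (1 / 2 : ℝ) • (vecMulVec α β + vecMulVec β α)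

/-- Jacobian matrix of a map. -/
def jac {n k : ℕ} (φ : (Fin n → ℝ) → (Fin k → ℝ)) (x : Fin n → ℝ) : Matrix (Fin k) (Fin n) ℝ :=
  Matrix.of fun i μ => pd μ (fun y => φ y i) x

/-- Pullback of a 1-form. -/
def pull1 {n k : ℕ} (φ : (Fin n → ℝ) → (Fin k → ℝ)) (α : Form1 k) : Form1 n :=
  fun x => α (φ x) ᵥ* jac φ x

/-- Pullback of a bilinear form field (a symmetric one, or a 2-form). -/
def pull2 {n k : ℕ} (φ : (Fin n → ℝ) → (Fin k → ℝ))
    (B : (Fin k → ℝ) → Matrix (Fin k) (Fin k) ℝ) : (Fin n → ℝ) → Matrix (Fin n) (Fin n) ℝ :=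
  fun x => (jac φ x)ᵀ * B (φ x) * jac φ x

/-! Connections. -/

/-- Christoffel symbols `Γ^k_{ij}` of the Levi-Civita connection. -/
def christoffel {n : ℕ} (g : Metric n) (x : Fin n → ℝ) (k i j : Fin n) : ℝ :=
  (1 / 2) * ∑ l, (g x)⁻¹ k l *
    (pd i (fun y => g y l j) x + pd j (fun y => g y l i) x - pd l (fun y => g y i j) x)

/-- The frame `(e_j)` dual to a coframe: `frame θ x μ j` is the component of `e_j` along `∂_μ`. -/
def frame {n : ℕ} (θ : Coframe n) (x : Fin n → ℝ) : Matrix (Fin n) (Fin n) ℝ :=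
  (Matrix.of fun i μ => θ i x μ)⁻¹

/-- Connection 1-forms `ω^i_j(v) = θ^i(∇_v e_j)` of the Levi-Civita connection in a coframe. -/
def leviCivita {n : ℕ} (g : Metric n) (θ : Coframe n) : ConnForm n n :=
  fun i j x μ => ∑ ν, θ i x ν *
    (pd μ (fun y => frame θ y ν j) x + ∑ k, christoffel g x ν μ k * frame θ x k j)

/-- Curvature `dω + ω ∧ ω`. -/
def curvature {m n : ℕ} (ω : ConnForm m n) : Fin m → Fin m → Form2 n :=
  fun i j => d1 (ω i j) + ∑ k, wedge (ω i k) (ω k j)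

/-- Torsion `dθ^i + ω^i_j ∧ θ^j` of a connection in a coframe. -/
def torsion {n : ℕ} (ω : ConnForm n n) (θ : Coframe n) : Fin n → Form2 n :=
  fun i => d1 (θ i) + ∑ j, wedge (ω i j) (θ j)

/-- Components `Ric_{jl} = Ω^i_j(e_i, e_l)` of the Ricci tensor of a metric in a coframe. -/
def ricci {n : ℕ} (g : Metric n) (θ : Coframe n) (x : Fin n → ℝ) : Matrix (Fin n) (Fin n) ℝ :=
  Matrix.of fun j l =>
    ∑ i, ((frame θ x)ᵀ * curvature (leviCivita g θ) i j x * frame θ x) i l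

/-- Components `g(e_i, e_j)` of a metric in a coframe. -/
def gram {n : ℕ} (g : Metric n) (θ : Coframe n) (x : Fin n → ℝ) : Matrix (Fin n) (Fin n) ℝ :=
  (frame θ x)ᵀ * g x * frame θ x

/-- Scalar curvature. -/
def scalarCurv {n : ℕ} (g : Metric n) (θ : Coframe n) (x : Fin n → ℝ) : ℝ :=
  ∑ i, ∑ j, (gram g θ x)⁻¹ i j * ricci g θ x i j

/-- Components, in a coframe, of the Schouten tensor `P = (Ric - R g / 8) / 3` of a metric in
dimension five. -/
def schouten (g : Metric 5) (θ : Coframe 5) (x : Fin 5 → ℝ) : Matrix (Fin 5) (Fin 5) ℝ :=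
  (1 / 3 : ℝ) • (ricci g θ x - (scalarCurv g θ x / 8) • gram g θ x)

/-- `P_i = P_{ij} θ^j`. -/
def schoutenForm (g : Metric 5) (θ : Coframe 5) (i : Fin 5) : Form1 5 :=
  fun x μ => ∑ j, schouten g θ x i j * θ j x μ

/-- `P^i = g^{ij} P_j`. -/
def schoutenFormUp (g : Metric 5) (θ : Coframe 5) (i : Fin 5) : Form1 5 :=
  fun x μ => ∑ j, (gram g θ x)⁻¹ i j * schoutenForm g θ j x μ

/-- `θ_i = g_{ij} θ^j`. -/
def coframeDown (g : Metric 5) (θ : Coframe 5) (i : Fin 5) : Form1 5 :=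
  fun x μ => ∑ j, gram g θ x i j * θ j x μ

/-- The Cartan normal conformal connection of `[g]`, in a coframe `θ` in which the representative
`g` has constant coefficients:
```
   0     -P_j     0
  θ^i    Γ^i_j   -P^i
   0      θ_j     0
```
where `Γ` is the Levi-Civita connection of `g` in the coframe. The rows and columns are numbered
`0, 1, …, 5, 6`, and the coframe `θ^1, …, θ^5` is indexed by `0, …, 4`. -/
def normalConformal (g : Metric 5) (θ : Coframe 5) : ConnForm 7 5 :=
  let Γ := leviCivita g θ
  let P := schoutenForm g θ
  let P' := schoutenFormUp g θ
  let η := coframeDown g θ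
  ![![0, -P 0, -P 1, -P 2, -P 3, -P 4, 0],
    ![θ 0, Γ 0 0, Γ 0 1, Γ 0 2, Γ 0 3, Γ 0 4, -P' 0],
    ![θ 1, Γ 1 0, Γ 1 1, Γ 1 2, Γ 1 3, Γ 1 4, -P' 1],
    ![θ 2, Γ 2 0, Γ 2 1, Γ 2 2, Γ 2 3, Γ 2 4, -P' 2],
    ![θ 3, Γ 3 0, Γ 3 1, Γ 3 2, Γ 3 3, Γ 3 4, -P' 3],
    ![θ 4, Γ 4 0, Γ 4 1, Γ 4 2, Γ 4 3, Γ 4 4, -P' 4],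
    ![0, η 0, η 1, η 2, η 3, η 4, 0]]

/-! The example. The coordinates on `J = ℝ⁵` are `(x, y, p, q, z)`, those on the ambient space
`J × ℝ₊ × ℝ`, seen inside `ℝ⁷`, are `(x, y, p, q, z, t, u)`. -/

/-- The coordinate differentials on `J`. -/
def dx : Fin 5 → ℝ := Pi.single 0 1
def dy : Fin 5 → ℝ := Pi.single 1 1
def dp : Fin 5 → ℝ := Pi.single 2 1
def dq : Fin 5 → ℝ := Pi.single 3 1
def dz : Fin 5 → ℝ := Pi.single 4 1

/-- The differentials of the two additional ambient coordinates. -/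
def dt : Fin 7 → ℝ := Pi.single 5 1
def du : Fin 7 → ℝ := Pi.single 6 1

/-- `F = q² + a₆ p⁶ + a₅ p⁵ + a₄ p⁴ + a₃ p³ + a₂ p² + a₁ p + a₀`. -/
def F (a : Fin 7 → ℝ) (X : Fin 5 → ℝ) : ℝ :=
  X 3 ^ 2 + a 6 * X 2 ^ 6 + a 5 * X 2 ^ 5 + a 4 * X 2 ^ 4 + a 3 * X 2 ^ 3 + a 2 * X 2 ^ 2
    + a 1 * X 2 + a 0

/-- The metric `g_F` on `J`. -/
def gF (a : Fin 7 → ℝ) : Metric 5 := fun X =>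
  let p := X 2
  let q := X 3
  ((2 : ℝ) ^ (2 / 3 : ℝ) / 15) •
    ((9 * a 2 + 27 * a 3 * p + 54 * a 4 * p ^ 2 + 90 * a 5 * p ^ 3 + 135 * a 6 * p ^ 4) • sp dy dy
    + (15 * a 0 - 6 * a 2 * p ^ 2 - 3 * a 3 * p ^ 3 + 9 * a 4 * p ^ 4 + 30 * a 5 * p ^ 5
        + 60 * a 6 * p ^ 6 + 5 * q ^ 2) • sp dx dx
    + (15 * a 1 + 12 * a 2 * p - 9 * a 3 * p ^ 2 - 48 * a 4 * p ^ 3 - 105 * a 5 * p ^ 4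
        - 180 * a 6 * p ^ 5) • sp dx dy
    + (20 : ℝ) • sp dp dp - (10 * q) • sp dp dx - (30 : ℝ) • sp dq dy - (15 : ℝ) • sp dx dz
    + (30 * p) • sp dq dx)

/-- The coframe `(θ^1, …, θ^5)` on `J`. -/
def coframeJ (a : Fin 7 → ℝ) : Coframe 5 :=
  ![fun X => dy - X 2 • dx,
    fun X => dz - F a X • dx - (2 * X 3) • (dp - X 3 • dx),
    fun X => (-((2 : ℝ) ^ (4 / 3 : ℝ) / √3)) • (dp - X 3 • dx),
    fun _ => ((2 : ℝ) ^ (-1 / 3 : ℝ)) • dx,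
    fun X =>
      let p := X 2
      (15 * (2 : ℝ) ^ (1 / 3 : ℝ))⁻¹ •
        ((9 * a 2 + 27 * a 3 * p + 54 * a 4 * p ^ 2 + 90 * a 5 * p ^ 3 + 135 * a 6 * p ^ 4)
            • (dy - p • dx)
          - (30 : ℝ) • dq
          + (15 * (a 1 + 2 * a 2 * p + 3 * a 3 * p ^ 2 + 4 * a 4 * p ^ 3 + 5 * a 5 * p ^ 4
              + 6 * a 6 * p ^ 5)) • dx)]

/-- The projection `(x, y, p, q, z, t, u) ↦ (x, y, p, q, z)`. -/
def proj (m : Fin 7 → ℝ) : Fin 5 → ℝ := ![m 0, m 1, m 2, m 3, m 4]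

/-- The point `(X, t, u)` of the ambient space. -/
def pt (X : Fin 5 → ℝ) (t u : ℝ) : Fin 7 → ℝ := ![X 0, X 1, X 2, X 3, X 4, t, u]

/-- The embedding of `J` onto the set `Σ = {t = 1, u = 0}`. -/
def incl (X : Fin 5 → ℝ) : Fin 7 → ℝ := pt X 1 0

/-- The coefficient of `-2tu` in the ambient metric, a symmetric bilinear form on `J`. -/
def ambientLin (a : Fin 7 → ℝ) : Metric 5 := fun X =>
  let p := X 2
  ((1 / 20) * (-2 * a 2 + 3 * a 3 * p + 6 * a 4 * p ^ 2 - 20 * a 5 * p ^ 3 - 120 * a 6 * p ^ 4))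
      • sp dx dx
    - ((9 / 20) * (a 3 - 10 * a 5 * p ^ 2 - 40 * a 6 * p ^ 3)) • sp dx dy
    - ((9 / 10) * (a 4 + 5 * a 5 * p + 15 * a 6 * p ^ 2)) • sp dy dy

/-- The coefficient of `u²` in the ambient metric, a symmetric bilinear form on `J`. -/
def ambientQuad (a : Fin 7 → ℝ) : Metric 5 := fun X =>
  let p := X 2
  (3 / (20 * (2 : ℝ) ^ (2 / 3 : ℝ)) * (a 4 - 10 * a 5 * p + 60 * a 6 * p ^ 2)) • sp dx dx
    + (9 / (4 * (2 : ℝ) ^ (2 / 3 : ℝ)) * (a 5 - 12 * a 6 * p)) • sp dx dy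
    + (81 / (4 * (2 : ℝ) ^ (2 / 3 : ℝ)) * a 6) • sp dy dy

/-- The ambient metric on `J × ℝ₊ × ℝ`. -/
def ambientMetric (a : Fin 7 → ℝ) : Metric 7 := fun m =>
  let t := m 5
  let u := m 6
  t ^ 2 • pull2 proj (gF a) m - (2 : ℝ) • sp dt du
    - (2 * t * u) • pull2 proj (ambientLin a) m + u ^ 2 • pull2 proj (ambientQuad a) m

/-- The coframe `(θ^0, …, θ^6)` on the ambient space: `θ^0 = dt`, `θ^6 = du`, and the pullbacks of
`θ^1, …, θ^5` between them. -/
def coframeM (a : Fin 7 → ℝ) : Coframe 7 :=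
  ![fun _ => dt, pull1 proj (coframeJ a 0), pull1 proj (coframeJ a 1), pull1 proj (coframeJ a 2),
    pull1 proj (coframeJ a 3), pull1 proj (coframeJ a 4), fun _ => du]

/-- The normal conformal connection of `[g_F]`. -/
def ωG2 (a : Fin 7 → ℝ) : ConnForm 7 5 := normalConformal (gF a) (coframeJ a)

/-- The Levi-Civita connection of the ambient metric. -/
def ωLC (a : Fin 7 → ℝ) : ConnForm 7 7 := leviCivita (ambientMetric a) (coframeM a)

/-- The pullback of the normal conformal connection to the ambient space. -/
def pullG2 (a : Fin 7 → ℝ) : ConnForm 7 7 := fun i j => pull1 proj (ωG2 a i j)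

end AmbientG2

end

/-! The metric on `M` has the form `t² g - 2 dt du - 2tu P + u² Q`, where `P` is the Schouten tensor
of `g = g_F`; it is a Fefferman-Graham ambient metric whose expansion stops at second order. All
claims then reduce to finite algebra in one explicit frame.

Put `A(p) = ∑ a_i p^i` and `v = u / 2^(2/3)`. Constant rescalings turn the `θ^i` into a coframe `η`
in which both metrics are `2^(2/3)` times a matrix over the ring of rational polynomials in `p, q,
t, 1/t, v, A, A', …, A⁽⁶⁾`. The frame vectors act on this ring by derivations, so the structure
functions, connection forms and curvatures have coefficients in it as well. Identities there are
decided by the kernel through `norm` and transferred to real functions by `ev_eq_ev` and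
`IsRealization`.

The Levi-Civita connection is guessed rather than computed: `connTable` is torsion-free and metric
(`norm_torsion`, `norm_metric`), and uniqueness (`leviCivita_eq`) does the rest. Its curvature gives
Ricci-flatness (`norm_ricci`), and its values at `t = 1`, `v = 0` are the blocks of the normal
conformal connection (`pull1_incl_ωLC_eq`).

Off `Σ` the torsion of the pulled-back connection contains `θ^1 ∧ dt`. The frame is constant along
the fibres of `π`, so the curvature depends on `t` and `u` as soon as one of its components does;
suitable components are multiples of `A⁽⁴⁾, A⁽⁵⁾, A⁽⁶⁾`, which have no common zero unless `a_4 = a_5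
= a_6 = 0`. Finally, forms pulled back from `J` are annihilated by `∂_u`, and the ambient curvature
on `Σ` is not. -/

namespace AmbientG2

/-! ### Differential polynomials

All coefficients in this computation are polynomials in `p`, `q`, `t`, `1/t`, a rescaled `u`, and
the derivatives of the polynomial `A(p) = ∑ a_i p^i`. They are represented by expressions, on which
derivations act formally and which a normaliser can compare. -/

/-- Polynomial expressions in four variables `p, q, t, v`, in `1/t`, and in the derivatives of a
function of `p`. -/
inductive JetExpr : Type
  | const (r : ℚ)
  | var (c : Fin 4)
  | tinv
  | A (i : ℕ)
  | add (e f : JetExpr)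
  | mul (e f : JetExpr)
  | neg (e : JetExpr)

namespace JetExpr

instance : Zero JetExpr := ⟨const 0⟩
instance : One JetExpr := ⟨const 1⟩
instance : Add JetExpr := ⟨add⟩
instance : Mul JetExpr := ⟨mul⟩
instance : Neg JetExpr := ⟨neg⟩
instance : Sub JetExpr := ⟨fun e f => add e (neg f)⟩

/-- The sum of a finite family of expressions. -/
def sum {n : ℕ} (f : Fin n → JetExpr) : JetExpr := ((List.finRange n).map f).foldr add 0

/-- The `i`-th derivative of `∑ j, a_j p^j`. -/
noncomputable def potential (a : Fin 7 → ℝ) (i : ℕ) (p : ℝ) : ℝ :=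
  ∑ j : Fin 7, a j * ((j : ℕ).descFactorial i * p ^ ((j : ℕ) - i))

/-- The value of an expression. -/
noncomputable def ev (a : Fin 7 → ℝ) (s : Fin 4 → ℝ) : JetExpr → ℝ
  | const r => r
  | var c => s c
  | tinv => (s 2)⁻¹
  | A i => potential a i (s 0)
  | add e f => ev a s e + ev a s f
  | mul e f => ev a s e * ev a s f
  | neg e => -ev a s e

section
variable (a : Fin 7 → ℝ) (s : Fin 4 → ℝ)

@[simp] theorem ev_const (r : ℚ) : ev a s (const r) = r := rfl
@[simp] theorem ev_var (c : Fin 4) : ev a s (var c) = s c := rfl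
@[simp] theorem ev_tinv : ev a s tinv = (s 2)⁻¹ := rfl
@[simp] theorem ev_A (i : ℕ) : ev a s (A i) = potential a i (s 0) := rfl
@[simp] theorem ev_zero : ev a s 0 = 0 := Rat.cast_zero
@[simp] theorem ev_one : ev a s 1 = 1 := Rat.cast_one
@[simp] theorem ev_add (e f : JetExpr) : ev a s (e + f) = ev a s e + ev a s f := rfl
@[simp] theorem ev_mul (e f : JetExpr) : ev a s (e * f) = ev a s e * ev a s f := rfl
@[simp] theorem ev_neg (e : JetExpr) : ev a s (-e) = -ev a s e := rfl
@[simp] theorem ev_sub (e f : JetExpr) : ev a s (e - f) = ev a s e - ev a s f :=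
  (sub_eq_add_neg _ _).symm

@[simp] theorem ev_sum {n : ℕ} (f : Fin n → JetExpr) : ev a s (sum f) = ∑ i, ev a s (f i) := by
  have h : ∀ l : List JetExpr, ev a s (l.foldr add 0) = (l.map (ev a s)).sum := by
    intro l
    induction l with
    | nil => simp
    | cons e l ih => simp only [List.foldr_cons, List.map_cons, List.sum_cons, ← ih]; rfl
  rw [sum, h, List.map_map, ← Fin.sum_univ_def]
  rfl

end

theorem potential_eq_zero (a : Fin 7 → ℝ) {i : ℕ} (hi : 7 ≤ i) (p : ℝ) : potential a i p = 0 := by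
  refine Finset.sum_eq_zero fun j _ => ?_
  rw [Nat.descFactorial_of_lt (j.isLt.trans_le hi)]
  simp

theorem hasDerivAt_potential (a : Fin 7 → ℝ) (i : ℕ) (p : ℝ) :
    HasDerivAt (potential a i) (potential a (i + 1) p) p := by
  refine HasDerivAt.fun_sum fun j _ => ?_
  refine (((hasDerivAt_pow ((j : ℕ) - i) p).const_mul
    (((j : ℕ).descFactorial i : ℕ) : ℝ)).const_mul (a j)).congr_deriv ?_
  rw [Nat.descFactorial_succ, Nat.sub_sub]
  push_cast
  ring

/-- The derivation with given values on the four variables. -/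
def D (δ : Fin 4 → JetExpr) : JetExpr → JetExpr
  | const _ => 0
  | var c => δ c
  | tinv => -(tinv * tinv * δ 2)
  | A i => A (i + 1) * δ 0
  | add e f => D δ e + D δ f
  | mul e f => D δ e * f + e * D δ f
  | neg e => -D δ e

/-- Chain rule: a formal derivation computes the derivative along `w` as soon as it has the right
values on `p, q, t, v`. A single `L` serves all `w`, so that differentiability and the formula pass
through the induction together; `t ≠ 0` matters for `1/t` only. -/
theorem exists_hasFDerivAt {V : Type*} [NormedAddCommGroup V] [NormedSpace ℝ V] (a : Fin 7 → ℝ)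
    {ρ : V → Fin 4 → ℝ} {x : V} (hρ : ∀ c, DifferentiableAt ℝ (fun y => ρ y c) x) (ht : ρ x 2 ≠ 0)
    (e : JetExpr) : ∃ L : V →L[ℝ] ℝ, HasFDerivAt (fun y => ev a (ρ y) e) L x ∧
      ∀ (w : V) (δ : Fin 4 → JetExpr),
        (∀ c, fderiv ℝ (fun y => ρ y c) x w = ev a (ρ x) (δ c)) → L w = ev a (ρ x) (D δ e) := by
  induction e with
  | const r => exact ⟨0, hasFDerivAt_const _ _, fun w δ _ => by simp [D]⟩
  | var c => exact ⟨_, (hρ c).hasFDerivAt, fun w δ h => h c⟩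
  | tinv =>
    refine ⟨_, (hasDerivAt_inv ht).comp_hasFDerivAt x (hρ 2).hasFDerivAt, fun w δ h => ?_⟩
    simp only [FunLike.coe_smul, Pi.smul_apply, h, smul_eq_mul, D, ev_neg, ev_mul, ev_tinv]
    ring
  | A i =>
    refine ⟨_, (hasDerivAt_potential a i _).comp_hasFDerivAt x (hρ 0).hasFDerivAt, fun w δ h => ?_⟩
    simp [h, D]
  | add e f he hf =>
    obtain ⟨L, hL, hL'⟩ := he
    obtain ⟨K, hK, hK'⟩ := hf
    exact ⟨_, hL.add hK, fun w δ h => by simp [D, hL' w δ h, hK' w δ h]⟩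
  | mul e f he hf =>
    obtain ⟨L, hL, hL'⟩ := he
    obtain ⟨K, hK, hK'⟩ := hf
    refine ⟨_, hL.mul hK, fun w δ h => ?_⟩
    simp [D, hL' w δ h, hK' w δ h]
    ring
  | neg e he =>
    obtain ⟨L, hL, hL'⟩ := he
    exact ⟨_, hL.neg, fun w δ h => by simp [D, hL' w δ h]⟩

/-- Setting `t = 1` and `v = 0`. -/
def restrict : JetExpr → JetExpr
  | const r => const r
  | var c => if c = 2 then 1 else if c = 3 then 0 else var c
  | tinv => 1
  | A i => A i
  | add e f => restrict e + restrict f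
  | mul e f => restrict e * restrict f
  | neg e => -restrict e

/-- A normal form treats `t` and `v` as indeterminates and cannot see identities that hold only
along `t = 1`, `v = 0`. Substituting these values into the expression first brings such identities
within its reach. -/
theorem ev_restrict (a : Fin 7 → ℝ) {s : Fin 4 → ℝ} (h2 : s 2 = 1) (h3 : s 3 = 0) (e : JetExpr) :
    ev a s (restrict e) = ev a s e := by
  induction e with
  | const r => rfl
  | var c =>
    by_cases hc : c = 2
    · subst hc; simp [restrict, h2]
    by_cases hc' : c = 3
    · subst hc'; simp [restrict, h3]
    simp [restrict, hc, hc']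
  | tinv => simp [restrict, h2]
  | A i => rfl
  | add e f he hf => exact congrArg₂ (· + ·) he hf
  | mul e f he hf => exact congrArg₂ (· * ·) he hf
  | neg e he => exact congrArg (- ·) he

/-! #### Normal forms -/

/-- A term `r * t ^ k * m`, where `m` lists the exponents of the other variables. -/
abbrev Term := ℚ × ℤ × List ℕ

/-- The value of a monomial. -/
noncomputable def evMono : (ℕ → ℝ) → List ℕ → ℝ
  | _, [] => 1
  | w, k :: m => w 0 ^ k * evMono (fun i => w (i + 1)) m

/-- The product of monomials. -/
def mulMono : List ℕ → List ℕ → List ℕ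
  | [], m => m
  | k :: l, [] => k :: l
  | k :: l, k' :: m => (k + k') :: mulMono l m

theorem evMono_mulMono (l m : List ℕ) (w : ℕ → ℝ) :
    evMono w (mulMono l m) = evMono w l * evMono w m := by
  induction l generalizing m w with
  | nil => simp [mulMono, evMono]
  | cons k l ih =>
    cases m with
    | nil => simp [mulMono, evMono]
    | cons k' m => simp only [mulMono, evMono, ih, pow_add]; ring

theorem evMono_single (n : ℕ) (w : ℕ → ℝ) : evMono w (List.replicate n 0 ++ [1]) = w n := by
  induction n generalizing w with
  | zero => simp [evMono]
  | succ n ih => simp [List.replicate_succ, evMono, ih]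

/-- The value of a sum of terms. -/
noncomputable def evPoly (t : ℝ) (w : ℕ → ℝ) (P : List Term) : ℝ :=
  (P.map fun m => (m.1 : ℝ) * (t ^ m.2.1 * evMono w m.2.2)).sum

/-- Add a term to a polynomial. -/
def insertTerm (m : Term) : List Term → List Term
  | [] => if m.1 = 0 then [] else [m]
  | m' :: P =>
    if m.2 = m'.2 then (if m.1 + m'.1 = 0 then P else (m.1 + m'.1, m'.2) :: P)
    else m' :: insertTerm m P

/-- The sum of polynomials. -/
def addPoly (P Q : List Term) : List Term := P.foldr insertTerm Q

/-- The product of polynomials. -/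
def mulPoly (P Q : List Term) : List Term :=
  P.foldr (fun m R => addPoly
    (Q.map fun m' => (m.1 * m'.1, m.2.1 + m'.2.1, mulMono m.2.2 m'.2.2)) R) []

section
variable (t : ℝ) (w : ℕ → ℝ)

theorem evPoly_insertTerm (m : Term) (P : List Term) :
    evPoly t w (insertTerm m P) = (m.1 : ℝ) * (t ^ m.2.1 * evMono w m.2.2) + evPoly t w P := by
  induction P with
  | nil =>
    by_cases h : m.1 = 0 <;> simp [insertTerm, h, evPoly]
  | cons m' P ih =>
    by_cases h : m.2 = m'.2
    · by_cases h0 : m.1 + m'.1 = 0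
      · have h1 : (m.1 : ℝ) + m'.1 = 0 := by exact_mod_cast h0
        simp only [insertTerm, h, h0, if_true, evPoly, List.map_cons, List.sum_cons]
        linear_combination (-(t ^ m'.2.1 * evMono w m'.2.2)) * h1
      · simp only [insertTerm, h, h0, if_true, if_false, evPoly, List.map_cons, List.sum_cons]
        push_cast
        ring
    · simp only [evPoly] at ih
      simp only [insertTerm, h, if_false, evPoly, List.map_cons, List.sum_cons, ih]
      ring

theorem evPoly_addPoly (P Q : List Term) :
    evPoly t w (addPoly P Q) = evPoly t w P + evPoly t w Q := by
  induction P with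
  | nil => simp [addPoly, evPoly]
  | cons m P ih =>
    rw [addPoly, List.foldr_cons, evPoly_insertTerm, ← addPoly, ih]
    simp only [evPoly, List.map_cons, List.sum_cons]
    ring

theorem evPoly_mulPoly (ht : t ≠ 0) (P Q : List Term) :
    evPoly t w (mulPoly P Q) = evPoly t w P * evPoly t w Q := by
  induction P with
  | nil => simp [mulPoly, evPoly]
  | cons m P ih =>
    have h : ∀ R : List Term, evPoly t w
        (R.map fun m' => (m.1 * m'.1, m.2.1 + m'.2.1, mulMono m.2.2 m'.2.2)) =
        (m.1 : ℝ) * (t ^ m.2.1 * evMono w m.2.2) * evPoly t w R := by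
      intro R
      induction R with
      | nil => simp [evPoly]
      | cons m' R ih =>
        simp only [evPoly] at ih
        simp only [evPoly, List.map_cons, List.sum_cons, ih, evMono_mulMono, zpow_add₀ ht]
        push_cast
        ring
    rw [mulPoly, List.foldr_cons, evPoly_addPoly, h, ← mulPoly, ih]
    simp only [evPoly, List.map_cons, List.sum_cons]
    ring

end

/-- The normal form of an expression. -/
def norm : JetExpr → List Term
  | const r => if r = 0 then [] else [(r, 0, [])]
  | var c => if c = 2 then [(1, 1, [])] else [(1, 0, List.replicate c 0 ++ [1])]
  | tinv => [(1, -1, [])]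
  | A i => if 7 ≤ i then [] else [(1, 0, List.replicate (i + 4) 0 ++ [1])]
  | add e f => addPoly (norm e) (norm f)
  | mul e f => mulPoly (norm e) (norm f)
  | neg e => mulPoly [(-1, 0, [])] (norm e)

/-- Slots 0, 1, 3 of a monomial hold the exponents of `p, q, v`, and slot `i + 4` that of `A⁽ⁱ⁾`.
Slot 2 stays zero: the power of `t` is stored apart as an integer, which lets `t` and `1/t` cancel.
Dropping `A⁽ⁱ⁾` for `i ≥ 7` is sound because `A` has degree at most 6. -/
theorem evPoly_norm (a : Fin 7 → ℝ) {s : Fin 4 → ℝ} (ht : s 2 ≠ 0) (e : JetExpr) :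
    evPoly (s 2) (fun i => if h : i < 4 then s ⟨i, h⟩ else potential a (i - 4) (s 0)) (norm e) =
      ev a s e := by
  induction e with
  | const r => by_cases h : r = 0 <;> simp [norm, h, evPoly, evMono]
  | var c =>
    by_cases h : c = 2
    · subst h; simp [norm, evPoly, evMono]
    · simp [norm, h, evPoly, evMono_single]
  | tinv => simp [norm, evPoly, evMono]
  | A i =>
    by_cases h : 7 ≤ i
    · simp [norm, h, evPoly, potential_eq_zero]
    · simp [norm, h, evPoly, evMono_single]
  | add e f he hf => rw [norm, evPoly_addPoly, he, hf]; rfl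
  | mul e f he hf => rw [norm, evPoly_mulPoly _ _ ht, he, hf]; rfl
  | neg e he => rw [norm, evPoly_mulPoly _ _ ht, he]; simp [evPoly, evMono, ev]

/-- Only the soundness of `norm` is needed, not the converse; hence the terms of a normal form need
not be sorted. -/
theorem ev_eq_zero (a : Fin 7 → ℝ) {s : Fin 4 → ℝ} (ht : s 2 ≠ 0) {e : JetExpr}
    (h : norm e = []) : ev a s e = 0 := by
  rw [← evPoly_norm a ht, h]
  rfl

theorem ev_eq_ev (a : Fin 7 → ℝ) {s : Fin 4 → ℝ} (ht : s 2 ≠ 0) {e f : JetExpr}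
    (h : norm (e - f) = []) : ev a s e = ev a s f :=
  sub_eq_zero.1 ((ev_sub a s e f).symm.trans (ev_eq_zero a ht h))

end JetExpr

/-! ### Partial derivatives and frames -/

section
variable {n : ℕ}

theorem pd_congr {f g : (Fin n → ℝ) → ℝ} {x : Fin n → ℝ} (h : f =ᶠ[nhds x] g) (μ : Fin n) :
    pd μ f x = pd μ g x := by
  rw [pd, pd, h.fderiv_eq]

theorem pd_const_mul (c : ℝ) (f : (Fin n → ℝ) → ℝ) (μ : Fin n) (x : Fin n → ℝ) :
    pd μ (fun y => c * f y) x = c * pd μ f x := by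
  have h : (fun y => c * f y) = c • f := rfl
  rw [pd, pd, h, fderiv_const_smul_field]
  rfl

theorem pd_mul {f g : (Fin n → ℝ) → ℝ} {x : Fin n → ℝ} (hf : DifferentiableAt ℝ f x)
    (hg : DifferentiableAt ℝ g x) (μ : Fin n) :
    pd μ (fun y => f y * g y) x = pd μ f x * g x + f x * pd μ g x := by
  rw [pd, pd, pd, fderiv_fun_mul hf hg]
  simp
  ring

theorem pd_sum {ι : Type*} {s : Finset ι} {f : ι → (Fin n → ℝ) → ℝ} {x : Fin n → ℝ}
    (hf : ∀ i ∈ s, DifferentiableAt ℝ (f i) x) (μ : Fin n) :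
    pd μ (fun y => ∑ i ∈ s, f i y) x = ∑ i ∈ s, pd μ (f i) x := by
  rw [pd, fderiv_fun_sum hf]
  simp [pd]

theorem pd_const (c : ℝ) (μ : Fin n) (x : Fin n → ℝ) : pd μ (fun _ => c) x = 0 := by
  simp [pd]

/-- The partial derivative of a matrix-valued function. -/
noncomputable def pdMat {k m : Type*} (μ : Fin n) (A : (Fin n → ℝ) → Matrix k m ℝ) (x : Fin n → ℝ) :
    Matrix k m ℝ :=
  Matrix.of fun i j => pd μ (fun y => A y i j) x

variable {k m r : Type*}

theorem pdMat_transpose (A : (Fin n → ℝ) → Matrix k m ℝ) (μ : Fin n) (x : Fin n → ℝ) :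
    pdMat μ (fun y => (A y)ᵀ) x = (pdMat μ A x)ᵀ := rfl

variable [Fintype m]

theorem differentiableAt_matrix_mul {A : (Fin n → ℝ) → Matrix k m ℝ}
    {B : (Fin n → ℝ) → Matrix m r ℝ} {x : Fin n → ℝ}
    (hA : ∀ i j, DifferentiableAt ℝ (fun y => A y i j) x)
    (hB : ∀ i j, DifferentiableAt ℝ (fun y => B y i j) x) (i : k) (j : r) :
    DifferentiableAt ℝ (fun y => (A y * B y) i j) x := by
  simp only [Matrix.mul_apply]
  exact DifferentiableAt.fun_sum fun l _ => (hA i l).mul (hB l j)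

theorem pdMat_mul {A : (Fin n → ℝ) → Matrix k m ℝ} {B : (Fin n → ℝ) → Matrix m r ℝ}
    {x : Fin n → ℝ} (hA : ∀ i j, DifferentiableAt ℝ (fun y => A y i j) x)
    (hB : ∀ i j, DifferentiableAt ℝ (fun y => B y i j) x) (μ : Fin n) :
    pdMat μ (fun y => A y * B y) x = pdMat μ A x * B x + A x * pdMat μ B x := by
  ext i j
  simp only [pdMat, Matrix.of_apply, Matrix.add_apply, Matrix.mul_apply]
  rw [pd_sum (f := fun l y => A y i l * B y l j) fun l _ => (hA i l).mul (hB l j),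
    ← Finset.sum_add_distrib]
  exact Finset.sum_congr rfl fun l _ => pd_mul (hA i l) (hB l j) μ

end

section
variable {n : ℕ} {θ : Coframe n} {E : (Fin n → ℝ) → Matrix (Fin n) (Fin n) ℝ}

theorem frame_eq (hE : ∀ y, (Matrix.of fun i μ => θ i y μ) * E y = 1) (y : Fin n → ℝ) :
    frame θ y = E y :=
  Matrix.inv_eq_right_inv (hE y)

/-- A matrix vanishes if its components in a frame do. -/
theorem eq_of_frame_eq {T E : Matrix (Fin n) (Fin n) ℝ} (h : T * E = 1)
    {B C : Matrix (Fin n) (Fin n) ℝ} (hB : Eᵀ * B * E = Eᵀ * C * E) : B = C := by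
  have h' : E * T = 1 := mul_eq_one_comm.1 h
  have ht : Tᵀ * Eᵀ = 1 := by rw [← transpose_mul, h', transpose_one]
  have key : ∀ X : Matrix (Fin n) (Fin n) ℝ, X = Tᵀ * (Eᵀ * X * E) * T := fun X => by
    rw [show Tᵀ * (Eᵀ * X * E) * T = (Tᵀ * Eᵀ) * X * (E * T) by simp only [Matrix.mul_assoc], ht,
      h', Matrix.one_mul, Matrix.mul_one]
  rw [key B, key C, hB]

/-- Components of a wedge product in a frame. -/
theorem frame_wedge (α β : Form1 n) (x : Fin n → ℝ) (e : Matrix (Fin n) (Fin n) ℝ) (k l : Fin n) :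
    (eᵀ * wedge α β x * e) k l =
      (α x ᵥ* e) k * (β x ᵥ* e) l - (α x ᵥ* e) l * (β x ᵥ* e) k := by
  have h : wedge α β x = vecMulVec (α x) (β x) - vecMulVec (β x) (α x) := by
    ext μ ν
    simp only [wedge, Matrix.of_apply, Matrix.sub_apply, vecMulVec_apply]
    ring
  rw [h, Matrix.mul_sub, Matrix.sub_mul, mul_vecMulVec, vecMulVec_mul, mul_vecMulVec, vecMulVec_mul,
    mulVec_transpose, mulVec_transpose]
  simp only [Matrix.sub_apply, vecMulVec_apply]
  ring

theorem fderiv_eq_sum_pd (f : (Fin n → ℝ) → ℝ) (x w : Fin n → ℝ) :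
    fderiv ℝ f x w = ∑ μ, w μ * pd μ f x := by
  conv_lhs => rw [pi_eq_sum_univ' w]
  simp only [map_sum, map_smul, smul_eq_mul, pd]

/-- Components of an exterior derivative in a frame. -/
theorem frame_d1 (α : Form1 n) (x : Fin n → ℝ) (e : Matrix (Fin n) (Fin n) ℝ) (k l : Fin n) :
    (eᵀ * d1 α x * e) k l = ∑ ν, (fderiv ℝ (fun y => α y ν) x (fun μ => e μ k) * e ν l -
      fderiv ℝ (fun y => α y ν) x (fun μ => e μ l) * e ν k) := by
  simp only [fderiv_eq_sum_pd, Matrix.mul_apply, d1, Matrix.of_apply, Matrix.transpose_apply,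
    mul_sub, sub_mul, Finset.sum_sub_distrib, Finset.sum_mul]
  refine congrArg₂ _ rfl ?_
  rw [Finset.sum_comm]
  exact Finset.sum_congr rfl fun i _ => Finset.sum_congr rfl fun j _ => by ring

end

/-! ### The Levi-Civita connection -/

section
variable {n : ℕ} {g : Metric n} {θ : Coframe n} {E G : (Fin n → ℝ) → Matrix (Fin n) (Fin n) ℝ}
  {x : Fin n → ℝ}

/-- A torsion-free metric connection is the Levi-Civita connection. -/
theorem leviCivita_eq {ω : ConnForm n n}
    (hE : ∀ y, (Matrix.of fun i μ => θ i y μ) * E y = 1)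
    (hθ : ∀ i μ, DifferentiableAt ℝ (fun y => θ i y μ) x)
    (hE' : ∀ μ i, DifferentiableAt ℝ (fun y => E y μ i) x)
    (hg : ∀ y, g y = (Matrix.of fun i μ => θ i y μ)ᵀ * G y * Matrix.of fun i μ => θ i y μ)
    (hG : ∀ y, (G y)ᵀ = G y) (hG' : ∀ i j, DifferentiableAt ℝ (fun y => G y i j) x)
    (hdet : IsUnit (g x).det) (htors : ∀ i, torsion ω θ i x = 0)
    (hmet : ∀ μ i j, pd μ (fun y => G y i j) x =
      ∑ l, (ω l i x μ * G x l j + G x i l * ω l j x μ)) (i j : Fin n) :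
    leviCivita g θ i j x = ω i j x := by
  set T : (Fin n → ℝ) → Matrix (Fin n) (Fin n) ℝ := fun y => Matrix.of fun i μ => θ i y μ with hT
  set W : Fin n → Matrix (Fin n) (Fin n) ℝ := fun μ => Matrix.of fun i j => ω i j x μ with hW
  set K : Fin n → Matrix (Fin n) (Fin n) ℝ := fun μ => pdMat μ T x + W μ * T x with hK
  set Low : Fin n → Matrix (Fin n) (Fin n) ℝ := fun μ => (T x)ᵀ * G x * K μ with hLow
  have hTd : ∀ i μ, DifferentiableAt ℝ (fun y => T y i μ) x := hθ
  have hdG : ∀ μ, pdMat μ G x = (W μ)ᵀ * G x + G x * W μ := fun μ => by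
    ext i j
    simp only [pdMat, hmet, Finset.sum_add_distrib, Matrix.add_apply, Matrix.mul_apply, hW,
      Matrix.of_apply, Matrix.transpose_apply]
  -- Differentiating `g = Tᵀ G T` and inserting metricity leaves exactly the symmetrization of `Low
  -- μ`.
  have hdg : ∀ μ, pdMat μ g x = (Low μ)ᵀ + Low μ := fun μ => by
    have h1 : g = fun y => (T y)ᵀ * G y * T y := funext hg
    have hTt : ∀ i μ, DifferentiableAt ℝ (fun y => (T y)ᵀ i μ) x := fun i μ => hTd μ i
    rw [h1, pdMat_mul (differentiableAt_matrix_mul hTt hG') hTd, pdMat_mul hTt hG', pdMat_transpose,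
      hdG]
    simp only [hLow, hK, Matrix.transpose_mul, Matrix.transpose_add, hG x,
      Matrix.transpose_transpose, Matrix.mul_add, Matrix.add_mul, Matrix.mul_assoc]
    abel
  -- Since `K μ = ∂_μ T + ω_μ T`, vanishing torsion is the symmetry of `K` in its two coordinate
  -- indices.
  have hKs : ∀ i μ ν, K μ i ν = K ν i μ := fun i μ ν => by
    have h := congrFun (congrFun (htors i) μ) ν
    simp only [torsion, d1, wedge, Matrix.add_apply, Matrix.of_apply, Matrix.sum_apply,
      Pi.add_apply, Finset.sum_apply, Matrix.zero_apply, Finset.sum_sub_distrib] at h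
    change _ = (0 : ℝ) at h
    simp only [hK, pdMat, hT, hW, Matrix.add_apply, Matrix.of_apply, Matrix.mul_apply]
    linarith
  have hLs : ∀ l μ ν, Low μ l ν = Low ν l μ := fun l μ ν => by
    simp only [hLow, Matrix.mul_apply (N := K _), hKs _ μ ν]
  -- Koszul formula: by the symmetry of `Low`, four of the six terms cancel and the other two add up
  -- to `2 * Low μ l κ`. Hence the Christoffel matrix is `g⁻¹ Low μ = E K μ`.
  have hchr : ∀ μ ν κ, christoffel g x ν μ κ = (E x * K μ) ν κ := fun μ ν κ => by
    have hgl : (g x)⁻¹ * Low μ = E x * K μ := by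
      have : Low μ = g x * (E x * K μ) := by
        rw [hg x]
        change (T x)ᵀ * G x * K μ = (T x)ᵀ * G x * T x * (E x * K μ)
        rw [Matrix.mul_assoc _ (T x), ← Matrix.mul_assoc (T x), hE x, Matrix.one_mul]
      rw [this, Matrix.nonsing_inv_mul_cancel_left _ _ hdet]
    have hd : ∀ μ i j, pd μ (fun y => g y i j) x = Low μ j i + Low μ i j := fun μ i j =>
      congrFun (congrFun (hdg μ) i) j
    rw [christoffel, ← hgl, Matrix.mul_apply, Finset.mul_sum]
    refine Finset.sum_congr rfl fun l _ => ?_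
    rw [hd, hd, hd, hLs l κ μ, hLs κ μ l, hLs μ κ l]
    ring
  -- The derivative of `T E = 1` trades `T ∂E` for `-∂T E`, which cancels the derivative part of `K`
  -- and leaves `ω` alone.
  have hTE : ∀ μ, pdMat μ T x * E x + T x * pdMat μ E x = 0 := fun μ => by
    rw [← pdMat_mul hTd hE']
    ext i j
    simp only [pdMat, hT, hE, Matrix.of_apply, pd_const, Matrix.zero_apply]
  ext μ
  have key : leviCivita g θ i j x μ = (T x * (pdMat μ E x + E x * K μ * E x)) i j := by
    simp only [leviCivita, frame_eq hE, hchr, Matrix.mul_apply (M := T x), Matrix.add_apply,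
      Matrix.mul_apply (M := E x * K μ)]
    rfl
  have h2 : T x * (pdMat μ E x + E x * K μ * E x) = W μ := by
    rw [Matrix.mul_add, ← Matrix.mul_assoc, ← Matrix.mul_assoc, hE x, Matrix.one_mul, hK]
    simp only [Matrix.add_mul, Matrix.mul_assoc (W μ)]
    rw [hE x, Matrix.mul_one, ← add_assoc, add_comm (T x * _), hTE, zero_add]
  rw [key, h2]
  rfl

end

/-! ### Constant rescalings of a coframe -/

section
variable {n m : ℕ} (g : Metric n) (θ : Coframe n) {lam : Fin n → ℝ}

theorem frame_smul (hl : ∀ i, lam i ≠ 0) (x : Fin n → ℝ) (μ i : Fin n) :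
    frame (fun i => lam i • θ i) x μ i = (lam i)⁻¹ * frame θ x μ i := by
  have h : (Matrix.of fun i μ => (lam i • θ i) x μ) =
      diagonal lam * Matrix.of fun i μ => θ i x μ := by
    ext i μ
    simp [diagonal_mul]
  have hd : (diagonal lam)⁻¹ = diagonal fun i => (lam i)⁻¹ := by
    refine inv_eq_right_inv ?_
    rw [diagonal_mul_diagonal]
    simp [hl]
  rw [frame, h, Matrix.mul_inv_rev, hd, mul_diagonal, mul_comm]
  rfl

/-- A constant change of coframe has no inhomogeneous term, so the connection matrix is merely
conjugated by `diagonal lam`. This keeps the cube roots and `√3` out of the polynomial computation.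
-/
theorem leviCivita_smul (hl : ∀ i, lam i ≠ 0) (i j : Fin n) :
    leviCivita g (fun i => lam i • θ i) i j = (lam i * (lam j)⁻¹) • leviCivita g θ i j := by
  ext x μ
  simp only [leviCivita, frame_smul θ hl, pd_const_mul, Pi.smul_apply, smul_eq_mul, Finset.mul_sum]
  refine Finset.sum_congr rfl fun ν _ => ?_
  rw [mul_add, mul_add, mul_add, Finset.mul_sum, Finset.mul_sum, Finset.mul_sum]
  refine congrArg₂ _ (by ring) (Finset.sum_congr rfl fun l _ => by ring)

theorem d1_smul (c : ℝ) (α : Form1 n) : d1 (c • α) = c • d1 α := by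
  ext x μ ν
  simp only [d1, Pi.smul_apply, smul_eq_mul, pd_const_mul, Matrix.of_apply, Matrix.smul_apply]
  ring

theorem curvature_smul {μ : Fin m → ℝ} (hl : ∀ i, μ i ≠ 0) (ω : ConnForm m n) (i j : Fin m) :
    curvature (fun i j => (μ i * (μ j)⁻¹) • ω i j) i j = (μ i * (μ j)⁻¹) • curvature ω i j := by
  simp only [curvature, d1_smul, smul_add, Finset.smul_sum]
  refine congrArg _ (Finset.sum_congr rfl fun k _ => ?_)
  ext x κ ν
  simp only [wedge, Pi.smul_apply, smul_eq_mul, Matrix.of_apply, Matrix.smul_apply]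
  have := hl k
  field_simp

theorem ricci_smul (hl : ∀ i, lam i ≠ 0) (x : Fin n → ℝ) (j l : Fin n) :
    ricci g (fun i => lam i • θ i) x j l = (lam j)⁻¹ * (lam l)⁻¹ * ricci g θ x j l := by
  have h : leviCivita g (fun i => lam i • θ i) =
      fun i j => (lam i * (lam j)⁻¹) • leviCivita g θ i j := by
    ext1 i; ext1 j
    exact leviCivita_smul g θ hl i j
  simp only [ricci, h, Matrix.of_apply, Finset.mul_sum]
  refine Finset.sum_congr rfl fun i _ => ?_
  rw [curvature_smul hl]
  simp only [Matrix.mul_apply, Matrix.transpose_apply, frame_smul θ hl, Pi.smul_apply,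
    Matrix.smul_apply, smul_eq_mul, Finset.sum_mul, Finset.mul_sum]
  refine Finset.sum_congr rfl fun ν _ => Finset.sum_congr rfl fun κ _ => ?_
  have := hl i
  field_simp

end

/-- Curvature differentiates the connection forms, so agreement is required on a neighbourhood; for
the ambient metric the open set `t ≠ 0` provides it. -/
theorem curvature_congr {n m : ℕ} {ω ω' : ConnForm m n} {x : Fin n → ℝ}
    (h : ∀ᶠ y in nhds x, ∀ i j, ω i j y = ω' i j y) (i j : Fin m) :
    curvature ω i j x = curvature ω' i j x := by
  have hx := h.self_of_nhds
  ext μ ν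
  simp only [curvature, Pi.add_apply, Finset.sum_apply, Matrix.add_apply, Matrix.sum_apply, wedge,
    d1, Matrix.of_apply, hx]
  rw [pd_congr (h.mono fun y hy => congrFun (hy i j) ν),
    pd_congr (h.mono fun y hy => congrFun (hy i j) μ)]

/-! ### Connections with coefficients in differential polynomials -/

namespace JetExpr

section
variable {n : ℕ} (T E : Fin n → Fin n → JetExpr) (δ : Fin n → Fin 4 → JetExpr)
  (S W : Fin n → Fin n → Fin n → JetExpr)

/-- The components `dθ^m(e_k, e_l)` for a coframe `T` with dual frame `E`, when `e_k` acts as the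
derivation `δ k`. -/
def structOf (m k l : Fin n) : JetExpr :=
  sum fun ν => D (δ k) (T m ν) * E ν l - D (δ l) (T m ν) * E ν k

/-- The curvature components `Ω^i_j(e_k, e_l)` for the connection forms `∑ l, W l i j θ^l` and
`S m k l = dθ^m(e_k, e_l)`. -/
def curvOf (k l i j : Fin n) : JetExpr :=
  D (δ k) (W l i j) - D (δ l) (W k i j) + sum (fun m => W k i m * W l m j - W l i m * W k m j)
    + sum (fun m => W m i j * S m k l)

/-- The Ricci components `∑ i, Ω^i_j(e_i, e_l)`. -/
def ricciOf (j l : Fin n) : JetExpr := sum fun i => curvOf δ S W i l i j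

end

/-- Coordinates of `J` among those of the ambient space. -/
def coordJ : Fin 5 → Fin 7 := Fin.castAdd 2

/-- The frame directions of `J` among those of the ambient space. -/
def frameJ (i : Fin 5) : Fin 7 := i.succ.castSucc

abbrev p : JetExpr := var 0
abbrev q : JetExpr := var 1
abbrev t : JetExpr := var 2
abbrev v : JetExpr := var 3

/-- The coefficients in `dq = η⁵ + B η¹ + C η⁴`. -/
abbrev C : JetExpr := const (1 / 2) * A 1
abbrev B : JetExpr := const (3 / 20) * A 2

/-- The rational multiple `η` of the coframe of the ambient space. -/
def coframe : Fin 7 → Fin 7 → JetExpr :=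
  ![![0, 0, 0, 0, 0, 1, 0],
    ![-p, 1, 0, 0, 0, 0, 0],
    ![q * q - A 0, 0, -(const 2 * q), 0, 1, 0, 0],
    ![-q, 0, 1, 0, 0, 0, 0],
    ![1, 0, 0, 0, 0, 0, 0],
    ![B * p - C, -B, 0, 1, 0, 0, 0],
    ![0, 0, 0, 0, 0, 0, 1]]

/-- The frame dual to `coframe`: the columns are its vectors. -/
def dual : Fin 7 → Fin 7 → JetExpr :=
  ![![0, 0, 0, 0, 1, 0, 0],
    ![0, 1, 0, 0, p, 0, 0],
    ![0, 0, 0, 1, q, 0, 0],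
    ![0, B, 0, 0, C, 1, 0],
    ![0, 0, 1, const 2 * q, q * q + A 0, 0, 0],
    ![1, 0, 0, 0, 0, 0, 0],
    ![0, 0, 0, 0, 0, 0, 1]]

/-- The derivations given by the frame vectors. -/
def frameDeriv (l : Fin 7) : Fin 4 → JetExpr := ![dual 2 l, dual 3 l, dual 5 l, dual 6 l]

/-- The components `dη^m(e_k, e_l)`. -/
def struct : Fin 7 → Fin 7 → Fin 7 → JetExpr :=
  ![fun _ _ => 0,
    ![0, 0, 0, ![0, 0, 0, 0, -1, 0, 0], ![0, 0, 0, 1, 0, 0, 0], 0, 0],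
    ![0, ![0, 0, 0, -(const 2 * B), 0, 0, 0], 0, ![0, const 2 * B, 0, 0, 0, const 2, 0], 0,
      ![0, 0, 0, -const 2, 0, 0, 0], 0],
    ![0, ![0, 0, 0, 0, -B, 0, 0], 0, 0, ![0, B, 0, 0, 0, 1, 0], ![0, 0, 0, 0, -1, 0, 0], 0],
    fun _ _ => 0,
    ![0, ![0, 0, 0, const (3 / 20) * A 3, const (3 / 20) * q * A 3, 0, 0], 0,
      ![0, -(const (3 / 20) * A 3), 0, 0, -(const (7 / 20) * A 2), 0, 0],
      ![0, -(const (3 / 20) * q * A 3), 0, const (7 / 20) * A 2, 0, 0, 0], 0, 0],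
    fun _ _ => 0]

/-- The components, up to a constant factor, of the ambient metric. -/
def metric : Fin 7 → Fin 7 → JetExpr :=
  ![![0, 0, 0, 0, 0, 0, -1],
    ![0, const (3 / 40) * t * v * A 4 + const (9 / 320) * v * v * A 6, 0, 0,
      const (3 / 40) * t * v * A 3 + const (3 / 320) * v * v * A 5, -(t * t), 0],
    ![0, 0, 0, 0, -(const (1 / 2) * t * t), 0, 0],
    ![0, 0, 0, const (4 / 3) * t * t, 0, 0, 0],
    ![0, const (3 / 40) * t * v * A 3 + const (3 / 320) * v * v * A 5, -(const (1 / 2) * t * t), 0,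
      const (1 / 10) * t * v * A 2 + const (1 / 160) * v * v * A 4, 0, 0],
    ![0, -(t * t), 0, 0, 0, 0, 0],
    ![-1, 0, 0, 0, 0, 0, 0]]

/-- The inverse of `metric`. -/
def metricInv : Fin 7 → Fin 7 → JetExpr :=
  ![![0, 0, 0, 0, 0, 0, -1],
    ![0, 0, 0, 0, 0, -(tinv * tinv), 0],
    ![0, 0, -(const 4 * tinv * tinv * tinv * tinv * metric 4 4), 0, -(const 2 * tinv * tinv),
      -(const 2 * tinv * tinv * tinv * tinv * metric 1 4), 0],
    ![0, 0, 0, const (3 / 4) * tinv * tinv, 0, 0, 0],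
    ![0, 0, -(const 2 * tinv * tinv), 0, 0, 0, 0],
    ![0, -(tinv * tinv), -(const 2 * tinv * tinv * tinv * tinv * metric 1 4), 0, 0,
      -(tinv * tinv * tinv * tinv * metric 1 1), 0],
    ![-1, 0, 0, 0, 0, 0, 0]]

/-- The power `t ^ (-n)`. -/
def T : ℕ → JetExpr
  | 0 => 1
  | n + 1 => T n * tinv

/-- The connection forms of the ambient metric in the coframe `η`: the entries list the nonzero
components together with their indices. -/
def connTable : Fin 7 → Fin 7 → List (Fin 7 × JetExpr) :=
  ![![
      [],
      [(1, const (9 / 320) * v * A 6 + const (3 / 80) * t * A 4),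
       (4, const (3 / 320) * v * A 5 + const (3 / 80) * t * A 3)],
      [], [],
      [(1, const (3 / 320) * v * A 5 + const (3 / 80) * t * A 3),
       (4, const (1 / 160) * v * A 4 + const (1 / 20) * t * A 2)],
      [], []],
    ![
      [(1, T 1)],
      [(0, T 1)],
      [],
      [(4, -const (2 / 3))],
      [(3, const (1 / 3))],
      [], []],
    ![
      [(1, const (3 / 160) * T 3 * v * v * A 5 + const (3 / 40) * T 2 * v * A 3), (2, T 1),
       (4, const (1 / 80) * T 3 * v * v * A 4 + const (1 / 10) * T 2 * v * A 2)],
      [(0, const (3 / 160) * T 3 * v * v * A 5 + const (3 / 40) * T 2 * v * A 3),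
       (1, const (3 / 40) * q * T 1 * v * A 5 + const (3 / 10) * q * A 3),
       (3, const (3 / 160) * T 2 * v * v * A 6 - const (3 / 10) * A 2),
       (6, -(const (3 / 160) * T 2 * v * A 5) - const (3 / 40) * T 1 * A 3)],
      [(0, T 1)],
      [(1, const (3 / 160) * T 2 * v * v * A 6), (4, -(const (1 / 20) * T 1 * v * A 3)),
       (5, const (4 / 3))],
      [(0, const (1 / 80) * T 3 * v * v * A 4 + const (1 / 10) * T 2 * v * A 2),
       (3, -(const (1 / 20) * T 1 * v * A 3)),
       (4, -(const (1 / 160) * q * T 2 * v * v * A 5) - const (1 / 10) * q * T 1 * v * A 3),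
       (6, -(const (1 / 80) * T 2 * v * A 4) - const (1 / 10) * T 1 * A 2)],
      [(3, -const (2 / 3))],
      [(1, -(const (3 / 160) * T 2 * v * A 5) - const (3 / 40) * T 1 * A 3),
       (4, -(const (1 / 80) * T 2 * v * A 4) - const (1 / 10) * T 1 * A 2)]],
    ![
      [(3, T 1)],
      [(1, -(const (9 / 320) * T 1 * v * A 5) - const (9 / 80) * A 3),
       (4, const (9 / 1280) * T 2 * v * v * A 6 - const (3 / 20) * A 2)],
      [],
      [(0, T 1)],
      [(1, const (9 / 1280) * T 2 * v * v * A 6),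
       (4, const (3 / 640) * T 2 * v * v * A 5 + const (3 / 160) * T 1 * v * A 3),
       (5, const (1 / 2))],
      [(4, -const (1 / 2))],
      []],
    ![
      [(4, T 1)],
      [], [], [],
      [(0, T 1)],
      [], []],
    ![
      [(1, const (9 / 320) * T 3 * v * v * A 6 + const (3 / 80) * T 2 * v * A 4),
       (4, const (3 / 320) * T 3 * v * v * A 5 + const (3 / 80) * T 2 * v * A 3), (5, T 1)],
      [(0, const (9 / 320) * T 3 * v * v * A 6 + const (3 / 80) * T 2 * v * A 4),
       (3, -(const (3 / 80) * T 1 * v * A 5)), (4, -(const (3 / 80) * q * T 1 * v * A 5)),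
       (6, -(const (9 / 320) * T 2 * v * A 6) - const (3 / 80) * T 1 * A 4)],
      [],
      [(1, -(const (3 / 80) * T 1 * v * A 5) - const (3 / 20) * A 3),
       (4, -(const (3 / 320) * T 2 * v * v * A 6) - const (1 / 20) * T 1 * v * A 4
         - const (1 / 5) * A 2)],
      [(0, const (3 / 320) * T 3 * v * v * A 5 + const (3 / 80) * T 2 * v * A 3),
       (1, -(const (3 / 80) * q * T 1 * v * A 5) - const (3 / 20) * q * A 3),
       (3, -(const (3 / 320) * T 2 * v * v * A 6) - const (1 / 20) * T 1 * v * A 4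
         + const (3 / 20) * A 2),
       (4, -(const (3 / 320) * q * T 2 * v * v * A 6) - const (3 / 40) * q * T 1 * v * A 4),
       (6, -(const (3 / 320) * T 2 * v * A 5) - const (3 / 80) * T 1 * A 3)],
      [(0, T 1)],
      [(1, -(const (9 / 320) * T 2 * v * A 6) - const (3 / 80) * T 1 * A 4),
       (4, -(const (3 / 320) * T 2 * v * A 5) - const (3 / 80) * T 1 * A 3)]],
    ![
      [],
      [(1, const (3 / 80) * v * A 4), (4, const (3 / 80) * v * A 3), (5, -t)],
      [(4, -(const (1 / 2) * t))],
      [(3, const (4 / 3) * t)],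
      [(1, const (3 / 80) * v * A 3), (2, -(const (1 / 2) * t)), (4, const (1 / 20) * v * A 2)],
      [(1, -t)],
      []]]

/-- The components of the connection forms of the ambient metric in the coframe `η`. -/
def conn (l i j : Fin 7) : JetExpr := ((connTable i j).lookup l).getD 0

/-- The components of the connection forms of the metric on `J`. -/
def connJ (l i j : Fin 5) : JetExpr := restrict (conn (frameJ l) (frameJ i) (frameJ j))

/-! ### Formal structure equations of the ambient metric. -/

theorem metric_mul_metricInv (i j : Fin 7) :
    norm (sum (fun k => metric i k * metricInv k j) - if i = j then 1 else 0) = [] := by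
  decide +kernel +revert

theorem norm_struct (m k l : Fin 7) :
    norm (structOf coframe dual frameDeriv m k l - struct m k l) = [] := by
  decide +kernel +revert

/-- Together with `norm_metric`, this is the certificate for `connTable`: no derivation of the table
is needed, since these two properties characterize the Levi-Civita connection. -/
theorem norm_torsion (i k l : Fin 7) :
    norm (struct i k l + (conn k i l - conn l i k)) = [] := by
  decide +kernel +revert

theorem norm_metric (l i j : Fin 7) :
    norm (D (frameDeriv l) (metric i j) -
      sum fun m => conn l m i * metric m j + metric i m * conn l m j) = [] := by
  decide +kernel +revert

theorem norm_ricci (j l : Fin 7) : norm (ricciOf frameDeriv struct conn j l) = [] := by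
  decide +kernel +revert

end JetExpr
open JetExpr

/-! ### Realization of formal connections on `ℝⁿ` -/

section
variable {n : ℕ} (a : Fin 7 → ℝ) (T E : Fin n → Fin n → JetExpr) (δ : Fin n → Fin 4 → JetExpr)
  (S W : Fin n → Fin n → Fin n → JetExpr) (ρ : (Fin n → ℝ) → Fin 4 → ℝ) (σ : Fin n → ℝ)

/-- The coframe with coefficients `T`, up to a choice `σ` of units for the coordinates. -/
noncomputable def realCoframe : Coframe n := fun i x μ => ev a (ρ x) (T i μ) * σ μ

/-- The connection forms with components `W` in the coframe `T`. -/
noncomputable def realConn : ConnForm n n :=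
  fun i j x μ => ∑ l, ev a (ρ x) (W l i j) * realCoframe a T ρ σ l x μ

/-- The matrix of the frame with coefficients `E`. -/
noncomputable def realFrame (x : Fin n → ℝ) : Matrix (Fin n) (Fin n) ℝ :=
  Matrix.of fun μ i => (σ μ)⁻¹ * ev a (ρ x) (E μ i)

/-- `T` and `E` are dual to each other and the frame vectors act as the derivations `δ`. -/
structure IsRealization : Prop where
  unit_ne : ∀ μ, σ μ ≠ 0
  diff : ∀ c x, DifferentiableAt ℝ (fun y => ρ y c) x
  velocity : ∀ x l c, fderiv ℝ (fun y => ρ y c) x (fun μ => realFrame a E ρ σ x μ l) =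
    ev a (ρ x) (δ l c)
  dual : ∀ x i j, ∑ μ, ev a (ρ x) (T i μ) * ev a (ρ x) (E μ j) = if i = j then 1 else 0
  struct : ∀ m k l, norm (structOf T E δ m k l - S m k l) = []

variable {a T E δ S ρ σ}

namespace IsRealization

variable (h : IsRealization a T E δ S ρ σ) {x : Fin n → ℝ}
include h

theorem mul_frame (y : Fin n → ℝ) :
    (Matrix.of fun i μ => realCoframe a T ρ σ i y μ) * realFrame a E ρ σ y = 1 := by
  ext i j
  rw [Matrix.mul_apply, Matrix.one_apply, ← h.dual y i j]
  refine Finset.sum_congr rfl fun μ _ => ?_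
  have := h.unit_ne μ
  simp only [realCoframe, realFrame, Matrix.of_apply]
  field_simp

theorem vecMul_frame (y : Fin n → ℝ) (i l : Fin n) :
    (realCoframe a T ρ σ i y ᵥ* realFrame a E ρ σ y) l = if i = l then 1 else 0 := by
  have := congrFun (congrFun (h.mul_frame y) i) l
  rwa [Matrix.one_apply] at this

theorem conn_vecMul_frame (y : Fin n → ℝ) (i j l : Fin n) :
    (realConn a T W ρ σ i j y ᵥ* realFrame a E ρ σ y) l = ev a (ρ y) (W l i j) := by
  have h1 : realConn a T W ρ σ i j y =
      ∑ m, ev a (ρ y) (W m i j) • realCoframe a T ρ σ m y := by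
    ext μ
    simp [realConn]
  rw [h1, Matrix.sum_vecMul]
  simp only [Matrix.smul_vecMul, Finset.sum_apply, Pi.smul_apply, h.vecMul_frame, smul_eq_mul]
  simp

variable (ht : ρ x 2 ≠ 0)
include ht

theorem differentiableAt_ev (e : JetExpr) : DifferentiableAt ℝ (fun y => ev a (ρ y) e) x := by
  obtain ⟨L, hL, -⟩ := exists_hasFDerivAt a (fun c => h.diff c x) ht e
  exact hL.differentiableAt

theorem fderiv_ev (e : JetExpr) (l : Fin n) :
    fderiv ℝ (fun y => ev a (ρ y) e) x (fun μ => realFrame a E ρ σ x μ l) =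
      ev a (ρ x) (D (δ l) e) := by
  obtain ⟨L, hL, hL'⟩ := exists_hasFDerivAt a (fun c => h.diff c x) ht e
  rw [hL.fderiv]
  exact hL' _ _ fun c => h.velocity x l c

theorem differentiableAt_coframe (i μ : Fin n) :
    DifferentiableAt ℝ (fun y => realCoframe a T ρ σ i y μ) x :=
  (h.differentiableAt_ev ht _).mul_const _

theorem differentiableAt_frame (μ i : Fin n) :
    DifferentiableAt ℝ (fun y => realFrame a E ρ σ y μ i) x :=
  (h.differentiableAt_ev ht _).const_mul _

theorem frame_d1_coframe (m k l : Fin n) :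
    ((realFrame a E ρ σ x)ᵀ * d1 (realCoframe a T ρ σ m) x * realFrame a E ρ σ x) k l =
      ev a (ρ x) (S m k l) := by
  rw [frame_d1, ← ev_eq_ev a ht (h.struct m k l), structOf, ev_sum]
  refine Finset.sum_congr rfl fun ν _ => ?_
  have hν := h.unit_ne ν
  have h1 : ∀ k, fderiv ℝ (fun y => realCoframe a T ρ σ m y ν) x
      (fun μ => realFrame a E ρ σ x μ k) = ev a (ρ x) (D (δ k) (T m ν)) * σ ν := fun k => by
    simp only [realCoframe]
    rw [fderiv_mul_const (h.differentiableAt_ev ht _), mul_comm, ← h.fderiv_ev ht]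
    rfl
  rw [h1, h1]
  simp only [realFrame, Matrix.of_apply, ev_sub, ev_mul]
  field_simp

/-- Leibniz rule for `d(∑ W_m θ^m)`: differentiated coefficients give the first two terms, and each
`dθ^m` contributes its structure functions. -/
theorem frame_d1_conn (i j k l : Fin n) :
    ((realFrame a E ρ σ x)ᵀ * d1 (realConn a T W ρ σ i j) x * realFrame a E ρ σ x) k l =
      ev a (ρ x) (D (δ k) (W l i j)) - ev a (ρ x) (D (δ l) (W k i j)) +
        ∑ m, ev a (ρ x) (W m i j) * ev a (ρ x) (S m k l) := by
  have h1 : ∀ ν k, fderiv ℝ (fun y => realConn a T W ρ σ i j y ν) x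
      (fun μ => realFrame a E ρ σ x μ k) =
      ∑ m, (ev a (ρ x) (D (δ k) (W m i j)) * realCoframe a T ρ σ m x ν + ev a (ρ x) (W m i j) *
        fderiv ℝ (fun y => realCoframe a T ρ σ m y ν) x (fun μ => realFrame a E ρ σ x μ k)) :=
    fun ν k => by
      have hd : ∀ m, DifferentiableAt ℝ
          (fun y => ev a (ρ y) (W m i j) * realCoframe a T ρ σ m y ν) x :=
        fun m => (h.differentiableAt_ev ht _).mul (h.differentiableAt_coframe ht m ν)
      simp only [realConn]
      rw [fderiv_fun_sum fun m _ => hd m]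
      simp only [FunLike.coe_sum, Finset.sum_apply]
      refine Finset.sum_congr rfl fun m _ => ?_
      rw [fderiv_fun_mul (h.differentiableAt_ev ht _) (h.differentiableAt_coframe ht m ν),
        ← h.fderiv_ev ht]
      simp
      ring
  have h2 : ∀ k l, ∑ ν, (∑ m, ev a (ρ x) (D (δ k) (W m i j)) * realCoframe a T ρ σ m x ν) *
      realFrame a E ρ σ x ν l = ev a (ρ x) (D (δ k) (W l i j)) := fun k l => by
    have h3 : ∀ m, ∑ ν, realCoframe a T ρ σ m x ν * realFrame a E ρ σ x ν l =
      if m = l then 1 else 0 := fun m => h.vecMul_frame x m l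
    simp only [Finset.sum_mul, mul_assoc]
    rw [Finset.sum_comm]
    simp only [← Finset.mul_sum, h3]
    simp
  rw [frame_d1]
  simp only [h1, Finset.sum_add_distrib, add_mul, Finset.sum_sub_distrib, h2]
  simp only [← h.frame_d1_coframe ht, frame_d1, Finset.mul_sum, mul_sub, Finset.sum_mul,
    Finset.sum_sub_distrib]
  rw [Finset.sum_comm (f := fun ν m => _ * _ * realFrame a E ρ σ x ν l),
    Finset.sum_comm (f := fun ν m => _ * _ * realFrame a E ρ σ x ν k)]
  simp only [mul_assoc]
  ring

theorem frame_torsion (i k l : Fin n) :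
    ((realFrame a E ρ σ x)ᵀ * torsion (realConn a T W ρ σ) (realCoframe a T ρ σ) i x *
      realFrame a E ρ σ x) k l =
      ev a (ρ x) (S i k l + (W k i l - W l i k)) := by
  have h1 : torsion (realConn a T W ρ σ) (realCoframe a T ρ σ) i x =
    d1 (realCoframe a T ρ σ i) x +
      ∑ j, wedge (realConn a T W ρ σ i j) (realCoframe a T ρ σ j) x := by
    simp [torsion]
  rw [h1, Matrix.mul_add, Matrix.add_mul, Matrix.mul_sum, Matrix.sum_mul, Matrix.add_apply,
    h.frame_d1_coframe ht, Matrix.sum_apply]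
  simp only [frame_wedge, h.conn_vecMul_frame, h.vecMul_frame, Finset.sum_sub_distrib]
  simp

theorem frame_curvature (i j k l : Fin n) :
    ((realFrame a E ρ σ x)ᵀ * curvature (realConn a T W ρ σ) i j x * realFrame a E ρ σ x) k l =
      ev a (ρ x) (curvOf δ S W k l i j) := by
  have h1 : curvature (realConn a T W ρ σ) i j x =
    d1 (realConn a T W ρ σ i j) x +
      ∑ m, wedge (realConn a T W ρ σ i m) (realConn a T W ρ σ m j) x := by
    simp [curvature]
  rw [h1, Matrix.mul_add, Matrix.add_mul, Matrix.mul_sum, Matrix.sum_mul, Matrix.add_apply,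
    h.frame_d1_conn W ht, Matrix.sum_apply]
  simp only [frame_wedge, h.conn_vecMul_frame, curvOf, ev_add, ev_sub, ev_sum, ev_mul]
  ring

/-- If the components `W` and `G` satisfy the structure equations formally, then they are those of
the Levi-Civita connection. -/
theorem leviCivita_eq {G : Fin n → Fin n → JetExpr} {κ : ℝ} {g : Metric n}
    (hg : ∀ y, g y = (Matrix.of fun i μ => realCoframe a T ρ σ i y μ)ᵀ *
      (Matrix.of fun i j => κ * ev a (ρ y) (G i j)) *
        Matrix.of fun i μ => realCoframe a T ρ σ i y μ)
    (hG : ∀ i j, G i j = G j i) (hdet : IsUnit (g x).det)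
    (htors : ∀ i k l, norm (S i k l + (W k i l - W l i k)) = [])
    (hmet : ∀ l i j, norm (D (δ l) (G i j) -
      JetExpr.sum fun m => W l m i * G m j + G i m * W l m j) = []) (i j : Fin n) :
    leviCivita g (realCoframe a T ρ σ) i j x = realConn a T W ρ σ i j x := by
  refine AmbientG2.leviCivita_eq h.mul_frame (h.differentiableAt_coframe ht)
    (h.differentiableAt_frame ht) hg (fun y => ?_)
    (fun i j => (h.differentiableAt_ev ht (G i j)).const_mul κ) hdet (fun i => ?_)
    (fun μ i j => ?_) i j
  · ext i j
    simp only [Matrix.transpose_apply, Matrix.of_apply, hG i j]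
  · refine eq_of_frame_eq (h.mul_frame x) (C := 0) ?_
    ext k l
    rw [h.frame_torsion W ht, ev_eq_zero a ht (htors i k l)]
    simp
  · have key : (fun μ => pd μ (fun y => κ * ev a (ρ y) (G i j)) x) =
        fun μ => ∑ l, (realConn a T W ρ σ l i x μ * (κ * ev a (ρ x) (G l j)) +
          κ * ev a (ρ x) (G i l) * realConn a T W ρ σ l j x μ) := by
      -- Formal metricity concerns the frame directions. Pairing with a frame is injective on
      -- covectors, which recovers the statement for the coordinate directions.
      have hinj : Function.Injective fun w : Fin n → ℝ => w ᵥ* realFrame a E ρ σ x := by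
        refine Function.LeftInverse.injective
          (g := fun w => w ᵥ* Matrix.of fun i μ => realCoframe a T ρ σ i x μ) fun w => ?_
        change (w ᵥ* _) ᵥ* _ = w
        rw [Matrix.vecMul_vecMul, mul_eq_one_comm.1 (h.mul_frame x), Matrix.vecMul_one]
      refine hinj ?_
      ext l
      have h1 : ((fun μ => pd μ (fun y => κ * ev a (ρ y) (G i j)) x) ᵥ* realFrame a E ρ σ x) l =
          κ * ev a (ρ x) (D (δ l) (G i j)) := by
        rw [← h.fderiv_ev ht, fderiv_eq_sum_pd]
        simp only [pd_const_mul, vecMul, dotProduct, Finset.mul_sum]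
        exact Finset.sum_congr rfl fun μ _ => by ring
      have h2 : (fun μ => ∑ l, (realConn a T W ρ σ l i x μ * (κ * ev a (ρ x) (G l j)) +
          κ * ev a (ρ x) (G i l) * realConn a T W ρ σ l j x μ)) =
          ∑ l, ((κ * ev a (ρ x) (G l j)) • realConn a T W ρ σ l i x +
            (κ * ev a (ρ x) (G i l)) • realConn a T W ρ σ l j x) := by
        ext μ
        simp [mul_comm]
      change _ = ((fun μ => ∑ l, _) ᵥ* _) l
      rw [h2, Matrix.sum_vecMul]
      simp only [h1, Matrix.add_vecMul, Matrix.smul_vecMul, Finset.sum_apply, Pi.add_apply,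
        Pi.smul_apply, h.conn_vecMul_frame, smul_eq_mul, ev_eq_ev a ht (hmet l i j), ev_sum, ev_add,
        ev_mul, Finset.mul_sum]
      exact Finset.sum_congr rfl fun m _ => by ring
    exact congrFun key μ

theorem isUnit_det {G G' : Fin n → Fin n → JetExpr} {κ : ℝ} (hκ : κ ≠ 0) {g : Metric n}
    (hg : ∀ y, g y = (Matrix.of fun i μ => realCoframe a T ρ σ i y μ)ᵀ *
      (Matrix.of fun i j => κ * ev a (ρ y) (G i j)) *
        Matrix.of fun i μ => realCoframe a T ρ σ i y μ)
    (hG : ∀ i j, norm ((JetExpr.sum fun k => G i k * G' k j) - if i = j then 1 else 0) = []) :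
    IsUnit (g x).det := by
  have h1 := Matrix.isUnit_det_of_right_inverse (h.mul_frame x)
  have h2 : (Matrix.of fun i j => κ * ev a (ρ x) (G i j)) *
      (Matrix.of fun i j => κ⁻¹ * ev a (ρ x) (G' i j)) = 1 := by
    ext i j
    rw [Matrix.mul_apply, Matrix.one_apply]
    have := ev_eq_ev a ht (hG i j)
    rw [apply_ite (ev a (ρ x)), ev_one, ev_zero, ev_sum] at this
    rw [← this]
    refine Finset.sum_congr rfl fun k _ => ?_
    simp only [Matrix.of_apply, ev_mul]
    field_simp
  rw [hg, Matrix.det_mul, Matrix.det_mul, Matrix.det_transpose]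
  exact (h1.mul (Matrix.isUnit_det_of_right_inverse h2)).mul h1

theorem ricci_eq {g : Metric n}
    (hω : ∀ᶠ y in nhds x, ∀ i j, leviCivita g (realCoframe a T ρ σ) i j y =
      realConn a T W ρ σ i j y) (j l : Fin n) :
    ricci g (realCoframe a T ρ σ) x j l = ev a (ρ x) (ricciOf δ S W j l) := by
  simp only [ricci, Matrix.of_apply, curvature_congr hω, frame_eq h.mul_frame,
    h.frame_curvature W ht, ricciOf, ev_sum]

end IsRealization

end

/-! ### The example as a realization -/

namespace JetExpr

section
variable (a : Fin 7 → ℝ) (x : ℝ)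

theorem potential_0 : potential a 0 x = a 0 + a 1 * x + a 2 * x ^ 2 + a 3 * x ^ 3 + a 4 * x ^ 4 +
    a 5 * x ^ 5 + a 6 * x ^ 6 := by
  simp [potential, Fin.sum_univ_seven]

theorem potential_1 : potential a 1 x = a 1 + 2 * a 2 * x + 3 * a 3 * x ^ 2 + 4 * a 4 * x ^ 3 +
    5 * a 5 * x ^ 4 + 6 * a 6 * x ^ 5 := by
  simp [potential, Fin.sum_univ_seven]; ring

theorem potential_2 : potential a 2 x = 2 * a 2 + 6 * a 3 * x + 12 * a 4 * x ^ 2 +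
    20 * a 5 * x ^ 3 + 30 * a 6 * x ^ 4 := by
  simp [potential, Fin.sum_univ_seven, Nat.descFactorial]; ring

theorem potential_3 : potential a 3 x = 6 * a 3 + 24 * a 4 * x + 60 * a 5 * x ^ 2 +
    120 * a 6 * x ^ 3 := by
  simp [potential, Fin.sum_univ_seven, Nat.descFactorial]; ring

theorem potential_4 : potential a 4 x = 24 * a 4 + 120 * a 5 * x + 360 * a 6 * x ^ 2 := by
  simp [potential, Fin.sum_univ_seven, Nat.descFactorial]; ring

theorem potential_5 : potential a 5 x = 120 * a 5 + 720 * a 6 * x := by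
  simp [potential, Fin.sum_univ_seven, Nat.descFactorial]; ring

theorem potential_6 : potential a 6 x = 720 * a 6 := by
  simp [potential, Fin.sum_univ_seven, Nat.descFactorial]; ring

end

/-- The data of the metric on `J`, extracted from those of the ambient metric. -/
def coframeOnJ (i μ : Fin 5) : JetExpr := coframe (frameJ i) (coordJ μ)
def dualOnJ (μ i : Fin 5) : JetExpr := dual (coordJ μ) (frameJ i)
def derivOnJ (l : Fin 5) : Fin 4 → JetExpr := frameDeriv (frameJ l)
def structOnJ (m k l : Fin 5) : JetExpr := struct (frameJ m) (frameJ k) (frameJ l)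
def metricOnJ (i j : Fin 5) : JetExpr := restrict (metric (frameJ i) (frameJ j))

def metricInvOnJ (i j : Fin 5) : JetExpr := restrict (metricInv (frameJ i) (frameJ j))

/-- The components of the Schouten tensor of the metric on `J`. -/
def schoutenExpr : Fin 5 → Fin 5 → JetExpr :=
  ![![-(const (3 / 80) * A 4), 0, 0, -(const (3 / 80) * A 3), 0], 0, 0,
    ![-(const (3 / 80) * A 3), 0, 0, -(const (1 / 20) * A 2), 0], 0]

/-- The components of the quadratic part of the ambient metric. -/
def quadExpr : Fin 5 → Fin 5 → JetExpr :=
  ![![const (9 / 320) * A 6, 0, 0, const (3 / 320) * A 5, 0], 0, 0,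
    ![const (3 / 320) * A 5, 0, 0, const (1 / 160) * A 4, 0], 0]

/-! ### Formal structure equations of the metric on `J`. -/

theorem norm_structOnJ (m k l : Fin 5) :
    norm (structOf coframeOnJ dualOnJ derivOnJ m k l - structOnJ m k l) = [] := by
  decide +kernel +revert

theorem norm_torsionOnJ (i k l : Fin 5) :
    norm (structOnJ i k l + (connJ k i l - connJ l i k)) = [] := by
  decide +kernel +revert

theorem norm_metricOnJ (l i j : Fin 5) :
    norm (D (derivOnJ l) (metricOnJ i j) -
      sum fun m => connJ l m i * metricOnJ m j + metricOnJ i m * connJ l m j) = [] := by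
  decide +kernel +revert

theorem metricOnJ_mul_metricInvOnJ (i j : Fin 5) :
    norm (sum (fun k => metricOnJ i k * metricInvOnJ k j) - if i = j then 1 else 0) = [] := by
  decide +kernel +revert

theorem metricOnJ_symm (i j : Fin 5) : metricOnJ i j = metricOnJ j i := by
  fin_cases i <;> fin_cases j <;> rfl

theorem metric_symm (i j : Fin 7) : metric i j = metric j i := by
  fin_cases i <;> fin_cases j <;> rfl

/-- The factor is `n - 2 = 3`. By `norm_trace_schouten` the scalar curvature vanishes, so the
Schouten tensor is a third of the Ricci tensor and `schoutenExpr` deserves its name. -/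
theorem norm_ricciOnJ (j l : Fin 5) :
    norm (ricciOf derivOnJ structOnJ connJ j l - const 3 * schoutenExpr j l) = [] := by
  decide +kernel +revert

end JetExpr

/-- The constant `2 ^ (2 / 3)`. -/
noncomputable def scale : ℝ := (2 : ℝ) ^ (2 / 3 : ℝ)

theorem scale_def : scale = (2 : ℝ) ^ (2 / 3 : ℝ) := rfl

theorem scale_pos : 0 < scale := Real.rpow_pos_of_pos two_pos _

theorem scale_ne : scale ≠ 0 := scale_pos.ne'

/-- The values of the variables `p, q, t, v` on `J`. -/
def jetJ (X : Fin 5 → ℝ) : Fin 4 → ℝ := ![X 2, X 3, 1, 0]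

/-- The values of the variables `p, q, t, v` on the ambient space. -/
noncomputable def jetM (m : Fin 7 → ℝ) : Fin 4 → ℝ := ![m 2, m 3, m 5, m 6 / scale]

/-- The units of the ambient coordinates. -/
noncomputable def unitM : Fin 7 → ℝ := ![1, 1, 1, 1, 1, 1, scale⁻¹]

/-- The factors between the coframe `θ` and its rational multiple `η`. -/
noncomputable def factorJ : Fin 5 → ℝ :=
  ![1, 1, -((2 : ℝ) ^ (4 / 3 : ℝ) / √3), (2 : ℝ) ^ (-1 / 3 : ℝ), -(2 * ((2 : ℝ) ^ (1 / 3 : ℝ))⁻¹)]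

noncomputable def factorM : Fin 7 → ℝ :=
  ![1, factorJ 0, factorJ 1, factorJ 2, factorJ 3, factorJ 4, scale]

section
variable (a : Fin 7 → ℝ)

/-- The rational multiple of the coframe on `J`. -/
noncomputable def ηJ : Coframe 5 := realCoframe a coframeOnJ jetJ 1

/-- The rational multiple of the coframe on the ambient space. -/
noncomputable def ηM : Coframe 7 := realCoframe a coframe jetM unitM

theorem ηJ_zero (X : Fin 5 → ℝ) : ηJ a 0 X = dy - X 2 • dx := by
  ext μ
  fin_cases μ <;> simp [ηJ, realCoframe, coframeOnJ, coframe, frameJ, coordJ, jetJ, dx, dy]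

theorem ηJ_one (X : Fin 5 → ℝ) : ηJ a 1 X =
    dz - (2 * X 3) • dp + (X 3 ^ 2 - potential a 0 (X 2)) • dx := by
  ext μ
  fin_cases μ <;>
    simp [ηJ, realCoframe, coframeOnJ, coframe, frameJ, coordJ, jetJ, dx, dp, dz, sq]

theorem ηJ_two (X : Fin 5 → ℝ) : ηJ a 2 X = dp - X 3 • dx := by
  ext μ
  fin_cases μ <;> simp [ηJ, realCoframe, coframeOnJ, coframe, frameJ, coordJ, jetJ, dx, dp]

theorem ηJ_three (X : Fin 5 → ℝ) : ηJ a 3 X = dx := by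
  ext μ
  fin_cases μ <;> simp [ηJ, realCoframe, coframeOnJ, coframe, frameJ, coordJ, jetJ, dx]

theorem ηJ_four (X : Fin 5 → ℝ) : ηJ a 4 X = dq - (3 / 20 * potential a 2 (X 2)) • dy +
    (3 / 20 * potential a 2 (X 2) * X 2 - 1 / 2 * potential a 1 (X 2)) • dx := by
  ext μ
  fin_cases μ <;>
    simp [ηJ, realCoframe, coframeOnJ, coframe, frameJ, coordJ, jetJ, dx, dy, dq]

theorem coframeJ_eq : coframeJ a = fun i => factorJ i • ηJ a i := by
  ext i X μ
  fin_cases i <;>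
    simp [coframeJ, factorJ, ηJ_zero, ηJ_one, ηJ_two, ηJ_three, ηJ_four, F, potential_0,
      potential_1, potential_2] <;> ring

theorem ev_restrict_jetJ (X : Fin 5 → ℝ) (e : JetExpr) :
    ev a (jetJ X) (restrict e) = ev a (jetJ X) e :=
  ev_restrict a rfl rfl e

theorem gF_eq (X : Fin 5 → ℝ) : gF a X = (Matrix.of fun i μ => ηJ a i X μ)ᵀ *
    (Matrix.of fun i j => scale * ev a (jetJ X) (metricOnJ i j)) *
      Matrix.of fun i μ => ηJ a i X μ := by
  simp only [metricOnJ, ev_restrict_jetJ]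
  ext μ ν
  simp [gF, ← scale_def, sp, vecMulVec_apply, Matrix.mul_apply, Fin.sum_univ_five, metric, frameJ,
    jetJ, ηJ_zero, ηJ_one, ηJ_two, ηJ_three, ηJ_four, potential_0, potential_1, potential_2]
  ring

/-- The coefficient of `-2tu` is the Schouten tensor, as in the first-order term of any
Fefferman-Graham expansion; compare `schouten_gF`. -/
theorem ambientLin_eq (X : Fin 5 → ℝ) : ambientLin a X = (Matrix.of fun i μ => ηJ a i X μ)ᵀ *
    (Matrix.of fun i j => ev a (jetJ X) (schoutenExpr i j)) * Matrix.of fun i μ => ηJ a i X μ := by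
  ext μ ν
  simp [ambientLin, sp, vecMulVec_apply, Matrix.mul_apply, Fin.sum_univ_five, schoutenExpr, jetJ,
    ηJ_zero, ηJ_three, potential_2, potential_3, potential_4]
  ring

theorem ambientQuad_eq (X : Fin 5 → ℝ) : ambientQuad a X = (Matrix.of fun i μ => ηJ a i X μ)ᵀ *
    (Matrix.of fun i j => scale⁻¹ * ev a (jetJ X) (quadExpr i j)) *
      Matrix.of fun i μ => ηJ a i X μ := by
  ext μ ν
  simp [ambientQuad, ← scale_def, sp, vecMulVec_apply, Matrix.mul_apply, Fin.sum_univ_five,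
    quadExpr, jetJ, ηJ_zero, ηJ_three, potential_4, potential_5, potential_6]
  field_simp
  ring

theorem jac_proj (m : Fin 7 → ℝ) :
    jac proj m = Matrix.of fun i μ => if coordJ i = μ then 1 else 0 := by
  have h : ∀ y i, proj y i = y (coordJ i) := fun y i => by fin_cases i <;> rfl
  ext i μ
  have h2 : (fun y : Fin 7 → ℝ => y (coordJ i)) =
      ContinuousLinearMap.proj (R := ℝ) (coordJ i) := rfl
  simp only [jac, Matrix.of_apply, pd, h, h2, ContinuousLinearMap.fderiv]
  simp [Pi.single_apply]

theorem isRealizationJ :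
    IsRealization a coframeOnJ dualOnJ derivOnJ structOnJ jetJ 1 := by
  refine ⟨fun _ => one_ne_zero, fun c x => ?_, fun x l c => ?_, fun x i j => ?_, norm_structOnJ⟩
  · fin_cases c <;> simp [jetJ] <;> fun_prop
  · have hp : ∀ i : Fin 5, HasFDerivAt (fun y : Fin 5 → ℝ => y i)
      (ContinuousLinearMap.proj (R := ℝ) i) x := fun i => hasFDerivAt_apply i x
    fin_cases c <;> simp [jetJ, (hp _).fderiv, realFrame, derivOnJ, frameDeriv, dualOnJ, coordJ]
    all_goals fin_cases l <;> simp [frameJ, dual]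
  · fin_cases i <;> fin_cases j <;> simp [Fin.sum_univ_five, coframeOnJ, dualOnJ, coframe, frameJ,
      coordJ, dual] <;> ring

theorem isRealizationM :
    IsRealization a coframe JetExpr.dual frameDeriv struct jetM unitM := by
  refine ⟨fun μ => ?_, fun c x => ?_, fun x l c => ?_, fun x i j => ?_, norm_struct⟩
  · fin_cases μ <;> simp [unitM, scale_ne]
  · fin_cases c <;> simp [jetM] <;> fun_prop
  · have hp : ∀ i : Fin 7, HasFDerivAt (fun y : Fin 7 → ℝ => y i)
      (ContinuousLinearMap.proj (R := ℝ) i) x := fun i => hasFDerivAt_apply i x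
    have hs : fderiv ℝ (fun y : Fin 7 → ℝ => y 6 / scale) x =
      scale⁻¹ • (ContinuousLinearMap.proj (R := ℝ) 6) := by
      simp only [div_eq_inv_mul]
      exact ((hp 6).const_mul _).fderiv
    fin_cases c <;> simp [jetM, (hp _).fderiv, hs, realFrame, frameDeriv, unitM]
    rw [inv_mul_cancel_left₀ scale_ne]
  · fin_cases i <;> fin_cases j <;> simp [Fin.sum_univ_seven, coframe, dual] <;> ring

end

/-! ### Passing between `J` and the ambient space -/

/-- Extension by zero of a covector on `J`. -/
def extend (f : Fin 5 → ℝ) : Fin 7 → ℝ := ![f 0, f 1, f 2, f 3, f 4, 0, 0]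

theorem pull1_proj (α : Form1 5) (m : Fin 7 → ℝ) : pull1 proj α m = extend (α (proj m)) := by
  ext μ
  rw [pull1, jac_proj]
  fin_cases μ <;> simp [vecMul, dotProduct, Fin.sum_univ_five, coordJ, extend]

theorem pull2_proj (B : (Fin 5 → ℝ) → Matrix (Fin 5) (Fin 5) ℝ) (m : Fin 7 → ℝ) :
    pull2 proj B m = Matrix.of fun μ ν => extend (fun i => extend (B (proj m) i) ν) μ := by
  ext μ ν
  rw [pull2, jac_proj]
  fin_cases μ <;> fin_cases ν <;>
    simp [Matrix.mul_apply, Fin.sum_univ_five, coordJ, extend]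

theorem jac_incl (X : Fin 5 → ℝ) :
    jac incl X = Matrix.of fun μ i => if coordJ i = μ then 1 else 0 := by
  have hp : ∀ i : Fin 5, HasFDerivAt (fun y : Fin 5 → ℝ => y i)
    (ContinuousLinearMap.proj (R := ℝ) i) X := fun i => hasFDerivAt_apply i X
  ext μ i
  simp only [jac, Matrix.of_apply, pd]
  fin_cases μ <;> simp [incl, pt, (hp _).fderiv] <;> fin_cases i <;> simp [coordJ]

theorem pull1_incl (α : Form1 7) (X i) : pull1 incl α X i = α (incl X) (coordJ i) := by
  rw [pull1, jac_incl]
  simp [vecMul, dotProduct]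

theorem pull2_incl (B : (Fin 7 → ℝ) → Matrix (Fin 7) (Fin 7) ℝ) (X i j) :
    pull2 incl B X i j = B (incl X) (coordJ i) (coordJ j) := by
  rw [pull2, jac_incl]
  simp [Matrix.mul_apply]

section
variable (a : Fin 7 → ℝ)

theorem ηM_frameJ (i : Fin 5) (m : Fin 7 → ℝ) : ηM a (frameJ i) m = extend (ηJ a i (proj m)) := by
  ext μ
  fin_cases i <;> fin_cases μ <;>
    simp [ηM, ηJ, realCoframe, coframeOnJ, coframe, frameJ, coordJ, jetJ, jetM, extend, unitM, proj]

theorem coframeM_eq : coframeM a = fun i => factorM i • ηM a i := by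
  have h : ∀ i : Fin 5, pull1 proj (coframeJ a i) = factorJ i • ηM a (frameJ i) := fun i => by
    ext m μ
    rw [pull1_proj, coframeJ_eq, Pi.smul_apply, Pi.smul_apply, ηM_frameJ]
    fin_cases μ <;> simp [extend]
  ext i m μ
  simp only [coframeM, h]
  fin_cases i <;> simp [factorM, frameJ]
  all_goals
    fin_cases μ <;> simp [ηM, realCoframe, coframe, dt, du, unitM, scale_ne]

theorem pull2_proj_eq {B : (Fin 5 → ℝ) → Matrix (Fin 5) (Fin 5) ℝ} {G : Matrix (Fin 5) (Fin 5) ℝ}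
    {m : Fin 7 → ℝ} (hB : B (proj m) = (Matrix.of fun i μ => ηJ a i (proj m) μ)ᵀ * G *
      Matrix.of fun i μ => ηJ a i (proj m) μ) :
    pull2 proj B m = (Matrix.of fun i μ => ηM a (frameJ i) m μ)ᵀ * G *
      Matrix.of fun i μ => ηM a (frameJ i) m μ := by
  have h : (Matrix.of fun i μ => ηM a (frameJ i) m μ) =
      (Matrix.of fun i μ => ηJ a i (proj m) μ) * jac proj m := by
    ext i μ
    rw [Matrix.of_apply, ηM_frameJ, ← pull1_proj]
    rfl
  rw [h, pull2, hB, Matrix.transpose_mul]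
  simp only [Matrix.mul_assoc]

/-- With `u = 2^(2/3) v` the four terms of the metric all acquire the same factor `scale`: from
`g_F` itself, from `du`, from `u`, and from `u²` divided by the `2^(2/3)` in the quadratic
coefficient. -/
theorem ambientMetric_eq (m : Fin 7 → ℝ) :
    ambientMetric a m = (Matrix.of fun i μ => ηM a i m μ)ᵀ *
      (Matrix.of fun i j => scale * ev a (jetM m) (metric i j)) *
        Matrix.of fun i μ => ηM a i m μ := by
  have h0 : dt = ηM a 0 m := by
    ext μ; fin_cases μ <;> simp [ηM, realCoframe, coframe, dt, unitM]
  have h6 : du = scale • ηM a 6 m := by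
    ext μ; fin_cases μ <;> simp [ηM, realCoframe, coframe, du, unitM, scale_ne]
  obtain ⟨v, hv⟩ : ∃ v, m 6 = scale * v := ⟨m 6 / scale, (mul_div_cancel₀ _ scale_ne).symm⟩
  have hs := scale_ne
  have hj : jetM m = ![m 2, m 3, m 5, v] := by simp [jetM, hv, scale_ne]
  simp only [ambientMetric, pull2_proj_eq a (gF_eq a _), pull2_proj_eq a (ambientLin_eq a _),
    pull2_proj_eq a (ambientQuad_eq a _), hv, hj, h0, h6, metricOnJ, ev_restrict_jetJ]
  ext μ ν
  simp [sp, vecMulVec_apply, Matrix.mul_apply, Fin.sum_univ_five, Fin.sum_univ_seven, metric,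
    schoutenExpr, quadExpr, jetJ, proj, frameJ]
  field_simp
  ring

end

namespace JetExpr

/-! #### Identities between components -/

/-- This and the next four identities read the border of the normal conformal connection off the
table at `t = 1`, `v = 0`, along directions tangent to `Σ`. -/
theorem norm_conn_zero_row (l j : Fin 5) :
    norm (restrict (conn (frameJ l) 0 (frameJ j)) - -schoutenExpr j l) = [] := by
  decide +kernel +revert

theorem norm_conn_zero_col (l i : Fin 5) :
    norm (restrict (conn (frameJ l) (frameJ i) 0) - if i = l then 1 else 0) = [] := by
  decide +kernel +revert

theorem norm_conn_six_row (l j : Fin 5) :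
    norm (restrict (conn (frameJ l) 6 (frameJ j)) - metricOnJ j l) = [] := by
  decide +kernel +revert

theorem norm_conn_six_col (l i : Fin 5) :
    norm (restrict (conn (frameJ l) (frameJ i) 6) -
      -sum fun k => metricInvOnJ i k * schoutenExpr k l) = [] := by
  decide +kernel +revert

theorem norm_conn_corner (l : Fin 5) (i j : Fin 7) (hi : i = 0 ∨ i = 6) (hj : j = 0 ∨ j = 6) :
    norm (restrict (conn (frameJ l) i j)) = [] := by
  decide +kernel +revert

theorem norm_trace_schouten :
    norm (sum fun i => sum fun j => metricInvOnJ i j * schoutenExpr i j) = [] := by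
  decide +kernel

/-- The curvature components of the ambient metric. -/
def curv (k l i j : Fin 7) : JetExpr := curvOf frameDeriv struct conn k l i j

/-- The digits are `k l i j` in `Ω^i_j(e_k, e_l)`. The first six components exhibit a dependence on
`t` or `v`; the last three, with `k = 6`, are contractions with a multiple of `∂_u`. -/
theorem norm_curv_4103 :
    norm (curv 4 1 0 3 - (const (3 / 160) * v * A 6 + const (1 / 40) * t * A 4)) = [] := by
  decide +kernel

theorem norm_curv_3101 : norm (curv 3 1 0 1 - const (3 / 80) * t * A 5) = [] := by
  decide +kernel

theorem norm_curv_6156 : norm (curv 6 1 5 6 - -(const (9 / 320) * T 2 * A 6)) = [] := by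
  decide +kernel

theorem norm_curv_4304 : norm (curv 4 3 0 4 - const (1 / 160) * v * A 5) = [] := by
  decide +kernel

theorem norm_curv_4114 : norm (curv 4 1 1 4 -
    (-(const (3 / 640) * T 2 * v * v * A 6) - const (1 / 160) * T 1 * v * A 4)) = [] := by
  decide +kernel

theorem norm_curv_4124 : norm (curv 4 1 2 4 - (const (3 / 400) * T 1 * v * A 2 * A 3
    + const (3 / 1600) * T 2 * v * v * A 2 * A 5 - const (3 / 6400) * T 2 * v * v * A 3 * A 4
    - const (9 / 12800) * T 3 * v * v * v * A 3 * A 6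
    - const (9 / 102400) * T 4 * v * v * v * v * A 5 * A 6)) = [] := by
  decide +kernel

theorem norm_curv_6101 : norm (curv 6 1 0 1 - const (9 / 320) * A 6) = [] := by
  decide +kernel

theorem norm_curv_6104 : norm (curv 6 1 0 4 - const (3 / 320) * A 5) = [] := by
  decide +kernel

theorem norm_curv_6404 : norm (curv 6 4 0 4 - const (1 / 160) * A 4) = [] := by
  decide +kernel

end JetExpr

/-! ### Connections and curvatures of the example -/

theorem factorJ_ne (i : Fin 5) : factorJ i ≠ 0 := by
  fin_cases i <;> simp [factorJ]

theorem factorM_ne (i : Fin 7) : factorM i ≠ 0 := by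
  fin_cases i <;> simp [factorM, factorJ_ne, scale_ne]

theorem factorM_frameJ (i : Fin 5) : factorM (frameJ i) = factorJ i := by
  fin_cases i <;> rfl

/-- The irrational factors enter `2θ^1θ^5 - 2θ^2θ^4 + (θ^3)²` only through this square and through
the products for the pairs `(1, 5)` and `(2, 4)`, each a rational multiple of `scale`. -/
theorem factorJ_two_sq : factorJ 2 * factorJ 2 = 4 / 3 * scale := by
  have h : (2 : ℝ) ^ (4 / 3 : ℝ) * (2 : ℝ) ^ (4 / 3 : ℝ) = 4 * (2 : ℝ) ^ (2 / 3 : ℝ) := by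
    rw [← Real.rpow_add two_pos, show (4 / 3 + 4 / 3 : ℝ) = 2 + 2 / 3 by norm_num,
      Real.rpow_add two_pos]
    norm_num
  have h3 : √(3 : ℝ) * √3 = 3 := Real.mul_self_sqrt (by norm_num)
  change -((2 : ℝ) ^ (4 / 3 : ℝ) / √3) * -((2 : ℝ) ^ (4 / 3 : ℝ) / √3) = 4 / 3 * scale
  rw [neg_mul_neg, div_mul_div_comm, h, h3, scale]
  ring

theorem factorJ_three : factorJ 3 = scale / 2 := by
  change (2 : ℝ) ^ (-1 / 3 : ℝ) = scale / 2
  rw [scale, show (-1 / 3 : ℝ) = 2 / 3 - 1 by norm_num, Real.rpow_sub_one two_ne_zero]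

theorem factorJ_four : factorJ 4 = -scale := by
  change -(2 * ((2 : ℝ) ^ (1 / 3 : ℝ))⁻¹) = -scale
  rw [← Real.rpow_neg two_pos.le, show (-(1 / 3) : ℝ) = 2 / 3 - 1 by norm_num,
    Real.rpow_sub_one two_ne_zero, scale]
  ring

section
variable (a : Fin 7 → ℝ)

theorem linearIndependent_coframeJ (X : Fin 5 → ℝ) :
    LinearIndependent ℝ fun i => coframeJ a i X := by
  have h1 : LinearIndependent ℝ fun i => ηJ a i X :=
    Matrix.linearIndependent_rows_of_isUnit
      ((Matrix.isUnit_iff_isUnit_det _).2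
        (Matrix.isUnit_det_of_right_inverse ((isRealizationJ a).mul_frame X)))
  rw [coframeJ_eq]
  exact h1.units_smul fun i => Units.mk0 _ (factorJ_ne i)

theorem gF_eq_sp (X : Fin 5 → ℝ) : gF a X = (2 : ℝ) • sp (coframeJ a 0 X) (coframeJ a 4 X)
    - (2 : ℝ) • sp (coframeJ a 1 X) (coframeJ a 3 X) + sp (coframeJ a 2 X) (coframeJ a 2 X) := by
  have h0 : factorJ 0 = 1 := rfl
  have h1 : factorJ 1 = 1 := rfl
  rw [gF_eq]
  simp only [coframeJ_eq, metricOnJ, ev_restrict_jetJ]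
  ext μ ν
  simp [sp, vecMulVec_apply, Matrix.mul_apply, Fin.sum_univ_five, metric, frameJ, jetJ, h0, h1,
    factorJ_three, factorJ_four]
  linear_combination (-(ηJ a 2 X μ * ηJ a 2 X ν)) * factorJ_two_sq

theorem isUnit_det_ambientMetric {m : Fin 7 → ℝ} (hm : m 5 ≠ 0) :
    IsUnit (ambientMetric a m).det :=
  (isRealizationM a).isUnit_det hm scale_ne (ambientMetric_eq a) metric_mul_metricInv

theorem leviCivita_ambientMetric {m : Fin 7 → ℝ} (hm : m 5 ≠ 0) (i j : Fin 7) :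
    leviCivita (ambientMetric a) (ηM a) i j m = realConn a coframe conn jetM unitM i j m :=
  (isRealizationM a).leviCivita_eq conn hm (ambientMetric_eq a) metric_symm
    (isUnit_det_ambientMetric a hm) norm_torsion norm_metric i j

theorem eventually_leviCivita_ambientMetric {m : Fin 7 → ℝ} (hm : m 5 ≠ 0) :
    ∀ᶠ y in nhds m, ∀ i j, leviCivita (ambientMetric a) (ηM a) i j y =
      realConn a coframe conn jetM unitM i j y :=
  ((continuous_apply 5).continuousAt.eventually_ne hm).mono fun _ hy i j =>
    leviCivita_ambientMetric a hy i j

theorem ricci_ambientMetric {m : Fin 7 → ℝ} (hm : m 5 ≠ 0) :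
    ricci (ambientMetric a) (coframeM a) m = 0 := by
  ext j l
  rw [coframeM_eq, ricci_smul _ _ factorM_ne]
  erw [(isRealizationM a).ricci_eq conn hm (eventually_leviCivita_ambientMetric a hm)]
  rw [ev_eq_zero a hm (norm_ricci j l), mul_zero]
  rfl

theorem ωLC_eq : ωLC a = fun i j =>
    (factorM i * (factorM j)⁻¹) • leviCivita (ambientMetric a) (ηM a) i j := by
  ext1 i; ext1 j
  rw [ωLC, coframeM_eq, leviCivita_smul _ _ factorM_ne]

theorem torsion_ωLC {m : Fin 7 → ℝ} (hm : m 5 ≠ 0) (i : Fin 7) :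
    torsion (ωLC a) (coframeM a) i m = 0 := by
  have h1 : torsion (ωLC a) (coframeM a) i m =
      factorM i • torsion (realConn a coframe conn jetM unitM) (ηM a) i m := by
    ext μ ν
    simp only [torsion, coframeM_eq, ωLC_eq, d1_smul, Pi.add_apply, Pi.smul_apply,
      Finset.sum_apply, Matrix.add_apply, Matrix.smul_apply, Matrix.sum_apply, smul_eq_mul, mul_add,
      Finset.mul_sum, wedge, Matrix.of_apply, leviCivita_ambientMetric a hm]
    refine congrArg _ (Finset.sum_congr rfl fun j _ => ?_)
    have := factorM_ne j
    field_simp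
  have h2 : torsion (realConn a coframe conn jetM unitM) (ηM a) i m = 0 := by
    refine eq_of_frame_eq ((isRealizationM a).mul_frame m) (C := 0) ?_
    ext k l
    erw [(isRealizationM a).frame_torsion conn hm, ev_eq_zero a hm (norm_torsion i k l)]
    simp
  rw [h1, h2, smul_zero]

theorem frame_curvature_ωLC {m : Fin 7 → ℝ} (hm : m 5 ≠ 0) (i j k l : Fin 7) :
    ((realFrame a JetExpr.dual jetM unitM m)ᵀ * curvature (ωLC a) i j m *
      realFrame a JetExpr.dual jetM unitM m) k l =
      factorM i * (factorM j)⁻¹ * ev a (jetM m) (curv k l i j) := by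
  rw [ωLC_eq, curvature_smul factorM_ne, Pi.smul_apply,
    curvature_congr (eventually_leviCivita_ambientMetric a hm), Matrix.mul_smul, Matrix.smul_mul,
    Matrix.smul_apply, (isRealizationM a).frame_curvature conn hm, smul_eq_mul]
  rfl

/-! ### Levi-Civita connection and Schouten tensor of `g_F`. -/

theorem leviCivita_gF (X : Fin 5 → ℝ) (i j : Fin 5) :
    leviCivita (gF a) (ηJ a) i j X = realConn a coframeOnJ connJ jetJ 1 i j X :=
  (isRealizationJ a).leviCivita_eq connJ one_ne_zero (gF_eq a) metricOnJ_symm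
    ((isRealizationJ a).isUnit_det one_ne_zero scale_ne (gF_eq a) metricOnJ_mul_metricInvOnJ)
    norm_torsionOnJ norm_metricOnJ i j

theorem ricci_gF (X : Fin 5 → ℝ) (j l : Fin 5) : ricci (gF a) (coframeJ a) X j l =
    (factorJ j)⁻¹ * (factorJ l)⁻¹ * (3 * ev a (jetJ X) (schoutenExpr j l)) := by
  rw [coframeJ_eq, ricci_smul _ _ factorJ_ne]
  erw [(isRealizationJ a).ricci_eq connJ one_ne_zero
    (Filter.Eventually.of_forall fun y i j => leviCivita_gF a y i j)]
  rw [ev_eq_ev a one_ne_zero (norm_ricciOnJ j l)]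
  simp

theorem gram_gF (X : Fin 5 → ℝ) : gram (gF a) (coframeJ a) X = Matrix.of fun i j =>
    (factorJ i)⁻¹ * (factorJ j)⁻¹ * (scale * ev a (jetJ X) (metricOnJ i j)) := by
  have hf : frame (coframeJ a) X =
      realFrame a dualOnJ jetJ 1 X * diagonal fun i => (factorJ i)⁻¹ := by
    ext μ i
    rw [coframeJ_eq, frame_smul _ factorJ_ne, mul_diagonal, mul_comm]
    exact congrArg (· * _) (congrFun (congrFun (frame_eq (isRealizationJ a).mul_frame X) μ) i)
  have h1 := (isRealizationJ a).mul_frame X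
  have h2 := congrArg Matrix.transpose h1
  rw [Matrix.transpose_mul, Matrix.transpose_one] at h2
  rw [gram, hf, gF_eq, Matrix.transpose_mul, diagonal_transpose]
  simp only [← Matrix.mul_assoc]
  rw [Matrix.mul_assoc (diagonal _) (realFrame _ _ _ _ _)ᵀ]
  erw [h2]
  rw [Matrix.mul_one, Matrix.mul_assoc (_ * _) _ (realFrame _ _ _ _ _)]
  erw [h1]
  ext i j
  rw [Matrix.mul_one, mul_diagonal, diagonal_mul, Matrix.of_apply, Matrix.of_apply]
  ring

theorem gram_gF_inv (X : Fin 5 → ℝ) : (gram (gF a) (coframeJ a) X)⁻¹ = Matrix.of fun i j =>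
    factorJ i * factorJ j * (scale⁻¹ * ev a (jetJ X) (metricInvOnJ i j)) := by
  refine Matrix.inv_eq_right_inv ?_
  ext i j
  have h := ev_eq_ev a (s := jetJ X) one_ne_zero (metricOnJ_mul_metricInvOnJ i j)
  rw [ev_sum, apply_ite (ev a (jetJ X)), ev_one, ev_zero] at h
  rw [gram_gF, Matrix.mul_apply, Matrix.one_apply]
  have h3 : ∀ k, (factorJ i)⁻¹ * (factorJ k)⁻¹ * (scale * ev a (jetJ X) (metricOnJ i k)) *
      (factorJ k * factorJ j * (scale⁻¹ * ev a (jetJ X) (metricInvOnJ k j))) =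
      (factorJ i)⁻¹ * factorJ j * ev a (jetJ X) (metricOnJ i k * metricInvOnJ k j) := fun k => by
    have := factorJ_ne k
    have := scale_ne
    rw [ev_mul]
    field_simp
  simp only [Matrix.of_apply, h3]
  rw [← Finset.mul_sum, h]
  split_ifs with hij
  · rw [hij, mul_one, inv_mul_cancel₀ (factorJ_ne j)]
  · rw [mul_zero]

theorem schouten_gF (X : Fin 5 → ℝ) (i j : Fin 5) : schouten (gF a) (coframeJ a) X i j =
    (factorJ i)⁻¹ * (factorJ j)⁻¹ * ev a (jetJ X) (schoutenExpr i j) := by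
  have h : scalarCurv (gF a) (coframeJ a) X = 0 := by
    have h1 := ev_eq_zero a (s := jetJ X) one_ne_zero norm_trace_schouten
    simp only [ev_sum, ev_mul] at h1
    rw [scalarCurv, ← mul_zero (3 * scale⁻¹), ← h1, Finset.mul_sum]
    refine Finset.sum_congr rfl fun i _ => ?_
    rw [Finset.mul_sum]
    refine Finset.sum_congr rfl fun j _ => ?_
    rw [gram_gF_inv, ricci_gF, Matrix.of_apply]
    have := factorJ_ne i
    have := factorJ_ne j
    field_simp
  rw [schouten, h, zero_div, zero_smul, sub_zero, Matrix.smul_apply, ricci_gF, smul_eq_mul]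
  ring

theorem schoutenForm_gF (X : Fin 5 → ℝ) (i μ : Fin 5) : schoutenForm (gF a) (coframeJ a) i X μ =
    (factorJ i)⁻¹ * ∑ l, ev a (jetJ X) (schoutenExpr i l) * ηJ a l X μ := by
  rw [schoutenForm, Finset.mul_sum]
  refine Finset.sum_congr rfl fun l _ => ?_
  rw [schouten_gF]
  simp only [coframeJ_eq, Pi.smul_apply, smul_eq_mul]
  have := factorJ_ne l
  field_simp

theorem schoutenFormUp_gF (X : Fin 5 → ℝ) (i μ : Fin 5) :
    schoutenFormUp (gF a) (coframeJ a) i X μ = factorJ i * scale⁻¹ *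
      ∑ l, (∑ k, ev a (jetJ X) (metricInvOnJ i k) * ev a (jetJ X) (schoutenExpr k l)) *
        ηJ a l X μ := by
  simp only [Finset.sum_mul]
  rw [Finset.sum_comm, schoutenFormUp, Finset.mul_sum]
  refine Finset.sum_congr rfl fun k _ => ?_
  rw [schoutenForm_gF, gram_gF_inv, Matrix.of_apply, Finset.mul_sum, Finset.mul_sum, Finset.mul_sum]
  refine Finset.sum_congr rfl fun l _ => ?_
  have := factorJ_ne k
  field_simp

theorem coframeDown_gF (X : Fin 5 → ℝ) (i μ : Fin 5) : coframeDown (gF a) (coframeJ a) i X μ =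
    scale * (factorJ i)⁻¹ * ∑ l, ev a (jetJ X) (metricOnJ i l) * ηJ a l X μ := by
  rw [coframeDown, Finset.mul_sum]
  refine Finset.sum_congr rfl fun l _ => ?_
  rw [gram_gF, Matrix.of_apply]
  simp only [coframeJ_eq, Pi.smul_apply, smul_eq_mul]
  have := factorJ_ne l
  field_simp

/-! ### Coincidence of the connections on `Σ`. -/

theorem ηM_incl_frameJ (X : Fin 5 → ℝ) (l μ : Fin 5) :
    ηM a (frameJ l) (incl X) (coordJ μ) = ηJ a l X μ := by
  have h : proj (incl X) = X := by ext i; fin_cases i <;> rfl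
  rw [ηM_frameJ, h]
  fin_cases μ <;> rfl

/-- The forms `dt` and `du` pull back to zero on `Σ`, so only the components along `η^1, …, η^5`
survive. -/
theorem pull1_incl_ωLC (X : Fin 5 → ℝ) (i j : Fin 7) (μ : Fin 5) :
    pull1 incl (ωLC a i j) X μ = factorM i * (factorM j)⁻¹ *
      ∑ l : Fin 5, ev a (jetJ X) (restrict (conn (frameJ l) i j)) * ηJ a l X μ := by
  have hj : jetM (incl X) = jetJ X := by
    ext c; fin_cases c <;> simp [jetM, jetJ, incl, pt]
  have h5 : incl X 5 ≠ 0 := one_ne_zero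
  have h0 : ηM a 0 (incl X) (coordJ μ) = 0 := by
    fin_cases μ <;> simp [ηM, realCoframe, coframe, coordJ]
  have h6 : ηM a 6 (incl X) (coordJ μ) = 0 := by
    fin_cases μ <;> simp [ηM, realCoframe, coframe, coordJ]
  rw [pull1_incl, ωLC_eq]
  simp only [Pi.smul_apply, leviCivita_ambientMetric a h5, smul_eq_mul, realConn, hj]
  refine congrArg _ ?_
  change ∑ l, ev a (jetJ X) (conn l i j) * ηM a l (incl X) (coordJ μ) = _
  simp only [ev_restrict_jetJ, ← ηM_incl_frameJ]
  rw [Fin.sum_univ_castSucc, Fin.sum_univ_succ]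
  have e6 : ηM a (Fin.last 6) (incl X) (coordJ μ) = 0 := h6
  have e0 : ηM a (Fin.castSucc 0) (incl X) (coordJ μ) = 0 := h0
  rw [e6, e0, mul_zero, mul_zero, add_zero, zero_add]
  rfl

theorem eq_zero_or_frameJ_or_six (i : Fin 7) : i = 0 ∨ (∃ k, i = frameJ k) ∨ i = 6 := by
  decide +revert

/-- The comparison goes block by block. The border uses the `norm_conn` identities; the middle block
needs none, because `connJ` is the restricted table and `leviCivita_gF` has already identified it.
-/
theorem pull1_incl_ωLC_eq (i j : Fin 7) : pull1 incl (ωLC a i j) = ωG2 a i j := by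
  ext X μ
  have hJ : jetJ X 2 ≠ 0 := one_ne_zero
  rw [pull1_incl_ωLC]
  have hcorner : (i = 0 ∨ i = 6) → (j = 0 ∨ j = 6) → factorM i * (factorM j)⁻¹ *
      ∑ l : Fin 5, ev a (jetJ X) (restrict (conn (frameJ l) i j)) * ηJ a l X μ = 0 :=
    fun hi hj => by
      simp only [ev_eq_zero a hJ (norm_conn_corner _ i j hi hj), zero_mul, Finset.sum_const_zero,
        mul_zero]
  have f0 : factorM 0 = 1 := rfl
  have f6 : factorM 6 = scale := rfl
  rcases eq_zero_or_frameJ_or_six i with hi | ⟨k, rfl⟩ | hi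
  · rcases eq_zero_or_frameJ_or_six j with hj | ⟨l, rfl⟩ | hj
    · rw [hcorner (.inl hi) (.inl hj), hi, hj]; rfl
    · have h : ωG2 a i (frameJ l) = -schoutenForm (gF a) (coframeJ a) l := by
        rw [hi]; fin_cases l <;> rfl
      rw [h]
      simp only [Pi.neg_apply, schoutenForm_gF, hi, ev_eq_ev a hJ (norm_conn_zero_row _ _), ev_neg,
        factorM_frameJ, f0, neg_mul, Finset.sum_neg_distrib]
      ring
    · rw [hcorner (.inl hi) (.inr hj), hi, hj]; rfl
  · rcases eq_zero_or_frameJ_or_six j with rfl | ⟨l, rfl⟩ | rfl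
    · have h : ωG2 a (frameJ k) 0 = coframeJ a k := by fin_cases k <;> rfl
      simp only [h, coframeJ_eq, ev_eq_ev a hJ (norm_conn_zero_col _ _), apply_ite (ev a (jetJ X)),
        ev_one, ev_zero, factorM_frameJ, f0]
      simp
    · have h : ωG2 a (frameJ k) (frameJ l) = leviCivita (gF a) (coframeJ a) k l := by
        fin_cases k <;> fin_cases l <;> rfl
      rw [h, coframeJ_eq, leviCivita_smul _ _ factorJ_ne, Pi.smul_apply, Pi.smul_apply,
        leviCivita_gF, factorM_frameJ, factorM_frameJ]
      rfl
    · have h : ωG2 a (frameJ k) 6 = -schoutenFormUp (gF a) (coframeJ a) k := by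
        fin_cases k <;> rfl
      simp only [h, Pi.neg_apply, schoutenFormUp_gF, ev_eq_ev a hJ (norm_conn_six_col _ _), ev_neg,
        ev_sum, ev_mul, factorM_frameJ, f6, neg_mul, Finset.sum_neg_distrib]
      ring
  · rcases eq_zero_or_frameJ_or_six j with hj | ⟨l, rfl⟩ | hj
    · rw [hcorner (.inr hi) (.inl hj), hi, hj]; rfl
    · have h : ωG2 a i (frameJ l) = coframeDown (gF a) (coframeJ a) l := by
        rw [hi]; fin_cases l <;> rfl
      rw [h]
      simp only [coframeDown_gF, hi, ev_eq_ev a hJ (norm_conn_six_row _ _), factorM_frameJ, f6]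
    · rw [hcorner (.inr hi) (.inr hj), hi, hj]; rfl

end

section
variable (a : Fin 7 → ℝ)

/-! ### Torsion of the normal conformal connection on the ambient space -/

theorem extend_coordJ (f : Fin 5 → ℝ) (i : Fin 5) : extend f (coordJ i) = f i := by
  fin_cases i <;> rfl

theorem proj_incl (X : Fin 5 → ℝ) : proj (incl X) = X := by
  ext i; fin_cases i <;> rfl

/-- The pullback evaluates connection forms only on vectors tangent to `Σ`. There they agree with
those of the ambient Levi-Civita connection, which is torsion-free. -/
theorem pull2_incl_torsion (i : Fin 7) :
    pull2 incl (torsion (pullG2 a) (coframeM a) i) = 0 := by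
  ext X μ ν
  have hω : ∀ i j μ, pullG2 a i j (incl X) (coordJ μ) = ωLC a i j (incl X) (coordJ μ) :=
    fun i j μ => by
      rw [pullG2, pull1_proj, extend_coordJ, proj_incl, ← pull1_incl_ωLC_eq, pull1_incl]
  have h : torsion (pullG2 a) (coframeM a) i (incl X) (coordJ μ) (coordJ ν) =
      torsion (ωLC a) (coframeM a) i (incl X) (coordJ μ) (coordJ ν) := by
    simp only [torsion, Pi.add_apply, Finset.sum_apply, Matrix.add_apply, Matrix.sum_apply, wedge,
      Matrix.of_apply, hω]
  rw [pull2_incl, h, torsion_ωLC a (m := incl X) one_ne_zero]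
  rfl

/-- The `(∂_y, ∂_t)` component equals 1: forms pulled back from `J` have no `dt` part and `dθ^1`
does not contribute, so only `θ^1 ∧ dt` remains. The pullback to `Σ` kills this term. -/
theorem torsion_pullG2_ne (m : Fin 7 → ℝ) : torsion (pullG2 a) (coframeM a) 1 m ≠ 0 := by
  have h0 : ∀ j, j ≠ 0 → coframeM a j m 5 = 0 := fun j hj => by
    fin_cases j
    · exact absurd rfl hj
    all_goals first
      | exact congrFun (pull1_proj _ m) 5
      | simp [coframeM, du]
  have h1 : coframeM a 0 m 5 = 1 := by simp [coframeM, dt]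
  have h2 : ∀ j, pullG2 a 1 j m 5 = 0 := fun j => congrFun (pull1_proj _ m) 5
  have h3 : pullG2 a 1 0 m 1 = 1 := by
    have h : ωG2 a 1 0 = coframeJ a 0 := rfl
    rw [pullG2, pull1_proj, h]
    simp [extend, coframeJ, dx, dy]
  have h4 : (fun y => coframeM a 1 y 5) = fun _ => 0 :=
    funext fun y => congrFun (pull1_proj _ y) 5
  have h5 : (fun y => coframeM a 1 y 1) = fun _ => 1 := funext fun y => by
    refine (congrFun (pull1_proj _ y) 1).trans ?_
    simp [extend, coframeJ, dx, dy]
  intro h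
  have h6 : torsion (pullG2 a) (coframeM a) 1 m 1 5 = 0 := by rw [h]; rfl
  simp only [torsion, Pi.add_apply, Finset.sum_apply, Matrix.add_apply, Matrix.sum_apply, wedge, d1,
    Matrix.of_apply, h4, h5, pd_const, h2, zero_mul, sub_zero, zero_add] at h6
  rw [Finset.sum_eq_single 0 (fun j _ hj => by rw [h0 j hj, mul_zero]) (by simp), h1, h3] at h6
  norm_num at h6

/-! ### Dependence of the ambient curvature on `t` and `u` -/

/-- The frame vectors depend on `p` and `q` only, so curvatures at two points of one fibre of `π`
can be compared through their frame components. -/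
theorem realFrame_pt (X : Fin 5 → ℝ) (t u t' u' : ℝ) :
    realFrame a JetExpr.dual jetM unitM (pt X t u) =
      realFrame a JetExpr.dual jetM unitM (pt X t' u') := by
  ext μ i
  fin_cases μ <;> fin_cases i <;> simp [realFrame, JetExpr.dual, jetM, pt]

theorem curvature_ne {X : Fin 5 → ℝ} {t u t' u' : ℝ} (ht : t ≠ 0) (ht' : t' ≠ 0) {k l i j : Fin 7}
    (h : ev a (jetM (pt X t u)) (curv k l i j) ≠ ev a (jetM (pt X t' u')) (curv k l i j)) :
    ∃ i j, curvature (ωLC a) i j (pt X t u) ≠ curvature (ωLC a) i j (pt X t' u') := by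
  refine ⟨i, j, fun hc => h ?_⟩
  have h1 := frame_curvature_ωLC a (m := pt X t u) ht i j k l
  rw [hc, realFrame_pt a X t u t' u', frame_curvature_ωLC a (m := pt X t' u') ht'] at h1
  exact (mul_left_cancel₀
    (mul_ne_zero (factorM_ne i) (inv_ne_zero (factorM_ne j))) h1).symm

/-- An expression for a curvature component allows to compute its values. -/
theorem ev_curv {X : Fin 5 → ℝ} {t : ℝ} (u : ℝ) (ht : t ≠ 0) {k l i j : Fin 7} {e : JetExpr}
    (h : norm (curv k l i j - e) = []) :
    ev a (jetM (pt X t u)) (curv k l i j) = ev a ![X 2, X 3, t, u / scale] e :=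
  ev_eq_ev a (s := jetM (pt X t u)) ht h

variable {a}

/-- The polynomial `A⁽⁴⁾` has degree at most 2; if it vanished at a point with its first two
derivatives, it would be zero. -/
theorem potential_ne (h : a 4 ≠ 0 ∨ a 5 ≠ 0 ∨ a 6 ≠ 0) (x : ℝ) :
    potential a 4 x ≠ 0 ∨ potential a 5 x ≠ 0 ∨ potential a 6 x ≠ 0 := by
  by_contra! hc
  obtain ⟨h4, h5, h6⟩ := hc
  rw [potential_6] at h6
  have h6' : a 6 = 0 := by linarith
  rw [potential_5, h6'] at h5
  have h5' : a 5 = 0 := by linarith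
  rw [potential_4, h6', h5'] at h4
  have h4' : a 4 = 0 := by linarith
  simp [h4', h5', h6'] at h

/-- The `t`-dependent parts of the three components are nonzero multiples of `t A⁽⁴⁾`, `t A⁽⁵⁾` and
`t⁻² A⁽⁶⁾`; the remaining term, in `v`, cancels in the comparison of `t = 1` with `t = 2`. -/
theorem curvature_depends_on_t (h : a 4 ≠ 0 ∨ a 5 ≠ 0 ∨ a 6 ≠ 0) (X : Fin 5 → ℝ) (u : ℝ) :
    ∃ i j, curvature (ωLC a) i j (pt X 1 u) ≠ curvature (ωLC a) i j (pt X 2 u) := by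
  have h1 : (1 : ℝ) ≠ 0 := one_ne_zero
  have h2 : (2 : ℝ) ≠ 0 := two_ne_zero
  rcases potential_ne h (X 2) with h | h | h
  · refine curvature_ne a h1 h2 (k := 4) (l := 1) (i := 0) (j := 3) fun hc => h ?_
    rw [ev_curv a u h1 norm_curv_4103, ev_curv a u h2 norm_curv_4103] at hc
    simp at hc
    linarith
  · refine curvature_ne a h1 h2 (k := 3) (l := 1) (i := 0) (j := 1) fun hc => h ?_
    rw [ev_curv a u h1 norm_curv_3101, ev_curv a u h2 norm_curv_3101] at hc
    simp at hc
    linarith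
  · refine curvature_ne a h1 h2 (k := 6) (l := 1) (i := 5) (j := 6) fun hc => h ?_
    rw [ev_curv a u h1 norm_curv_6156, ev_curv a u h2 norm_curv_6156] at hc
    simp [T] at hc
    exact hc.resolve_left (by norm_num)

/-- The two values of `u` are `v = 0` and `v = 1`. The case `A⁽⁶⁾ ≠ 0` is split off because in the
component used for `A⁽⁴⁾` a term in `A⁽⁶⁾` could cancel the difference. -/
theorem curvature_depends_on_u (h : a 4 ≠ 0 ∨ a 5 ≠ 0 ∨ a 6 ≠ 0) (X : Fin 5 → ℝ) {t : ℝ}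
    (ht : t ≠ 0) :
    ∃ i j, curvature (ωLC a) i j (pt X t 0) ≠ curvature (ωLC a) i j (pt X t scale) := by
  have hs := div_self scale_ne
  by_cases h6 : potential a 6 (X 2) = 0
  · by_cases h5 : potential a 5 (X 2) = 0
    · have h4 : potential a 4 (X 2) ≠ 0 := by simpa [h5, h6] using potential_ne h (X 2)
      refine curvature_ne a ht ht (k := 4) (l := 1) (i := 1) (j := 4) fun hc => ?_
      rw [ev_curv a _ ht norm_curv_4114, ev_curv a _ ht norm_curv_4114] at hc
      simp [T, hs, h6, ht, h4] at hc
    · refine curvature_ne a ht ht (k := 4) (l := 3) (i := 0) (j := 4) fun hc => h5 ?_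
      rw [ev_curv a _ ht norm_curv_4304, ev_curv a _ ht norm_curv_4304] at hc
      simp [hs] at hc
      linarith
  · refine curvature_ne a ht ht (k := 4) (l := 1) (i := 0) (j := 3) fun hc => h6 ?_
    rw [ev_curv a _ ht norm_curv_4103, ev_curv a _ ht norm_curv_4103] at hc
    simp [hs] at hc
    linarith

/-- For cubic `A` the chosen component reduces to `(3/400) (v/t) A'' A'''`. It vanishes where `v =
0` or `A'' = 0`, so `t` is tested at `v = 1` and over a suitable point of `J`. -/
theorem curvature_of_cubic (h3 : a 3 ≠ 0) (h : ¬ (a 4 ≠ 0 ∨ a 5 ≠ 0 ∨ a 6 ≠ 0)) :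
    ∃ X : Fin 5 → ℝ,
      (∃ i j, curvature (ωLC a) i j (pt X 1 scale) ≠ curvature (ωLC a) i j (pt X 2 scale)) ∧
      ∃ i j, curvature (ωLC a) i j (pt X 1 0) ≠ curvature (ωLC a) i j (pt X 1 scale) := by
  push Not at h
  obtain ⟨h4, h5, h6⟩ := h
  have h1 : (1 : ℝ) ≠ 0 := one_ne_zero
  have h2 : (2 : ℝ) ≠ 0 := two_ne_zero
  have hs := div_self scale_ne
  -- The value of `p` solves `A''(p) = 2 a_2 + 6 a_3 p = 1`; the other coordinates are irrelevant.
  refine ⟨fun _ => (1 - 2 * a 2) / (6 * a 3), ?_⟩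
  have e2 : potential a 2 ((1 - 2 * a 2) / (6 * a 3)) = 1 := by
    rw [potential_2, h4, h5, h6]
    field_simp
    ring
  have e3 : potential a 3 ((1 - 2 * a 2) / (6 * a 3)) = 6 * a 3 := by
    rw [potential_3, h4, h5, h6]
    ring
  constructor
  · refine curvature_ne a h1 h2 (k := 4) (l := 1) (i := 2) (j := 4) fun hc => h3 ?_
    rw [ev_curv a _ h1 norm_curv_4124, ev_curv a _ h2 norm_curv_4124] at hc
    simp [T, hs, e2, e3, potential_4, potential_5, potential_6, h4, h5, h6] at hc
    linarith
  · refine curvature_ne a h1 h1 (k := 4) (l := 1) (i := 2) (j := 4) fun hc => h3 ?_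
    rw [ev_curv a _ h1 norm_curv_4124, ev_curv a _ h1 norm_curv_4124] at hc
    simp [T, hs, e2, e3, potential_4, potential_5, potential_6, h4, h5, h6] at hc
    linarith

/-! ### Comparison of the curvatures on `Σ`. -/

theorem frame_pull2_proj (B : (Fin 5 → ℝ) → Matrix (Fin 5) (Fin 5) ℝ) (m : Fin 7 → ℝ) (l : Fin 7) :
    ((realFrame a JetExpr.dual jetM unitM m)ᵀ * pull2 proj B m *
      realFrame a JetExpr.dual jetM unitM m) 6 l = 0 := by
  have h : ∀ ν, ((realFrame a JetExpr.dual jetM unitM m)ᵀ * pull2 proj B m) 6 ν = 0 := fun ν => by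
    rw [Matrix.mul_apply, pull2_proj]
    simp [Fin.sum_univ_seven, realFrame, JetExpr.dual, extend]
  rw [Matrix.mul_apply]
  simp only [h, zero_mul, Finset.sum_const_zero]

/-- On `Σ`, contracting the ambient curvature with `e_6`, a multiple of `∂_u`, produces nonzero
multiples of `A⁽⁴⁾, A⁽⁵⁾, A⁽⁶⁾`, whereas `∂_u` annihilates whatever is pulled back from `J`. -/
theorem curvature_ne_pull2 (h : a 4 ≠ 0 ∨ a 5 ≠ 0 ∨ a 6 ≠ 0) (X : Fin 5 → ℝ) :
    ∃ i j, curvature (ωLC a) i j (incl X) ≠ pull2 proj (curvature (ωG2 a) i j) (incl X) := by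
  have key : ∀ {l i j : Fin 7}, ev a (jetM (pt X 1 0)) (curv 6 l i j) ≠ 0 →
      ∃ i j, curvature (ωLC a) i j (incl X) ≠ pull2 proj (curvature (ωG2 a) i j) (incl X) :=
    fun {l i j} hne => ⟨i, j, fun hc => by
      have h1 := frame_curvature_ωLC a (m := incl X) one_ne_zero i j 6 l
      rw [hc, frame_pull2_proj] at h1
      exact mul_ne_zero (mul_ne_zero (factorM_ne i) (inv_ne_zero (factorM_ne j))) hne h1.symm⟩
  rcases potential_ne h (X 2) with h | h | h
  · exact key (l := 4) (i := 0) (j := 4) (by simpa [ev_curv a 0 one_ne_zero norm_curv_6404] using h)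
  · exact key (l := 1) (i := 0) (j := 4) (by simpa [ev_curv a 0 one_ne_zero norm_curv_6104] using h)
  · exact key (l := 1) (i := 0) (j := 1) (by simpa [ev_curv a 0 one_ne_zero norm_curv_6101] using h)

end

end AmbientG2

theorem mainTheorem5 (a : Fin 7 → ℝ) :
    -- the coframe is one, and in it the metric has constant coefficients
    (∀ X : Fin 5 → ℝ, LinearIndependent ℝ (fun i => AmbientG2.coframeJ a i X) ∧
      AmbientG2.gF a X =
        (2 : ℝ) • AmbientG2.sp (AmbientG2.coframeJ a 0 X) (AmbientG2.coframeJ a 4 X)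
        - (2 : ℝ) • AmbientG2.sp (AmbientG2.coframeJ a 1 X) (AmbientG2.coframeJ a 3 X)
        + AmbientG2.sp (AmbientG2.coframeJ a 2 X) (AmbientG2.coframeJ a 2 X)) ∧
    -- the ambient metric is nondegenerate and Ricci-flat
    (∀ m : Fin 7 → ℝ, 0 < m 5 → (AmbientG2.ambientMetric a m).det ≠ 0 ∧
      AmbientG2.ricci (AmbientG2.ambientMetric a) (AmbientG2.coframeM a) m = 0) ∧
    -- the two connections coincide on `t = 1, u = 0`
    (∀ i j, AmbientG2.pull1 AmbientG2.incl (AmbientG2.ωLC a i j) = AmbientG2.ωG2 a i j) ∧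
    -- the torsion vanishes along `t = 1, u = 0` and is nonzero at every point off that set
    (∀ i, AmbientG2.pull2 AmbientG2.incl
      (AmbientG2.torsion (AmbientG2.pullG2 a) (AmbientG2.coframeM a) i) = 0) ∧
    (∀ m : Fin 7 → ℝ, 0 < m 5 → ¬ (m 5 = 1 ∧ m 6 = 0) →
      ∃ i, AmbientG2.torsion (AmbientG2.pullG2 a) (AmbientG2.coframeM a) i m ≠ 0) ∧
    -- the ambient curvature depends on `t` and on `u`
    ((a 3 ≠ 0 ∨ a 4 ≠ 0 ∨ a 5 ≠ 0 ∨ a 6 ≠ 0) →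
      (∃ (X : Fin 5 → ℝ) (t t' u : ℝ), 0 < t ∧ 0 < t' ∧
        ∃ i j, AmbientG2.curvature (AmbientG2.ωLC a) i j (AmbientG2.pt X t u) ≠
          AmbientG2.curvature (AmbientG2.ωLC a) i j (AmbientG2.pt X t' u)) ∧
      (∃ (X : Fin 5 → ℝ) (t u u' : ℝ), 0 < t ∧
        ∃ i j, AmbientG2.curvature (AmbientG2.ωLC a) i j (AmbientG2.pt X t u) ≠
          AmbientG2.curvature (AmbientG2.ωLC a) i j (AmbientG2.pt X t u'))) ∧
    ((a 4 ≠ 0 ∨ a 5 ≠ 0 ∨ a 6 ≠ 0) →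
      (∀ (X : Fin 5 → ℝ) (u : ℝ), ∃ t t' : ℝ, 0 < t ∧ 0 < t' ∧
        ∃ i j, AmbientG2.curvature (AmbientG2.ωLC a) i j (AmbientG2.pt X t u) ≠
          AmbientG2.curvature (AmbientG2.ωLC a) i j (AmbientG2.pt X t' u)) ∧
      (∀ (X : Fin 5 → ℝ) (t : ℝ), 0 < t → ∃ u u' : ℝ,
        ∃ i j, AmbientG2.curvature (AmbientG2.ωLC a) i j (AmbientG2.pt X t u) ≠
          AmbientG2.curvature (AmbientG2.ωLC a) i j (AmbientG2.pt X t u'))) ∧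
    -- at every point of `t = 1, u = 0` the two curvatures differ, as matrices of 2-forms on the
    -- tangent space of the ambient space
    ((a 4 ≠ 0 ∨ a 5 ≠ 0 ∨ a 6 ≠ 0) →
      ∀ X : Fin 5 → ℝ, ∃ i j, AmbientG2.curvature (AmbientG2.ωLC a) i j (AmbientG2.incl X) ≠
        AmbientG2.pull2 AmbientG2.proj (AmbientG2.curvature (AmbientG2.ωG2 a) i j)
          (AmbientG2.incl X)) := by
  refine ⟨fun X => ⟨AmbientG2.linearIndependent_coframeJ a X, AmbientG2.gF_eq_sp a X⟩,
    fun m hm => ⟨(AmbientG2.isUnit_det_ambientMetric a hm.ne').ne_zero,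
      AmbientG2.ricci_ambientMetric a hm.ne'⟩,
    AmbientG2.pull1_incl_ωLC_eq a, AmbientG2.pull2_incl_torsion a,
    fun m _ _ => ⟨1, AmbientG2.torsion_pullG2_ne a m⟩, fun h => ?_,
    fun h => ⟨fun X u => ⟨1, 2, one_pos, two_pos, AmbientG2.curvature_depends_on_t h X u⟩,
      fun X t ht => ⟨0, AmbientG2.scale, AmbientG2.curvature_depends_on_u h X ht.ne'⟩⟩,
    fun h => AmbientG2.curvature_ne_pull2 h⟩
  -- Nonzero `(a_4, a_5, a_6)` is covered by the pointwise statements; otherwise `A` is a genuine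
  -- cubic.
  by_cases h' : a 4 ≠ 0 ∨ a 5 ≠ 0 ∨ a 6 ≠ 0
  · exact ⟨⟨0, 1, 2, 0, one_pos, two_pos, AmbientG2.curvature_depends_on_t h' 0 0⟩,
      ⟨0, 1, 0, AmbientG2.scale, one_pos, AmbientG2.curvature_depends_on_u h' 0 one_ne_zero⟩⟩
  · obtain ⟨X, ht, hu⟩ := AmbientG2.curvature_of_cubic (h.resolve_right h') h'
    exact ⟨⟨X, 1, 2, AmbientG2.scale, one_pos, two_pos, ht⟩,
      ⟨X, 1, 0, AmbientG2.scale, one_pos, hu⟩⟩
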